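/- **Setting.** Let $d\in\{2,3\}$, let $\Omega\subset\mathbb R^d$ be a bounded Lipschitz domain, $\Gamma_D\subset\partial\Omega$ closed with positive surface measure, $\Gamma_N:=\partial\Omega\setminus\Gamma_D$, $f\in L^2(\Omega;\mathbb R^d)$, $g\in L^2(\Gamma_N;\mathbb R^d)$. Put $\mathbb S_d:=\{q\in\mathbb R^{d\times d}: q=q^T\}$, $\mathbb S_{d,0}:=\{q\in\mathbb S_d:\operatorname{tr}q=0\}$, $V:=\{v\in H^1(\Omega;\mathbb R^d): v=0\text{ on }\Gamma_D\}$, $Q:=L^2(\Omega;\mathbb S_{d,0})$, $M:=L^2(\Omega)$, $X:=V\times Q\times M$, $\varepsilon(v):=\frac12(\nabla v+(\nabla v)^T)$ and $\sigma(v,q):=\mathbb C(\varepsilon(v)-q)$, where $\mathbb C$ is a constant, symmetric, isotropic elasticity tensor on $\mathbb S_d$ with $\kappa_{\mathbb C}|\tau|^2\le\mathbb C\tau:\tau$ for some $\kappa_{\mathbb C}>0$. Let $\mathbb H$ be a symmetric (bounded, measurable, possibly constant) hardening tensor field on $\mathbb S_d$ with $\kappa_{\mathbb H}|\tau|^2\le\mathbb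 H\tau:\tau$ for some $\kappa_{\mathbb H}>0$, let $H>0$, $\sigma_y>0$, and let $j(q,\beta):=\sigma_y|q|$ if $|q|\le\beta$ and $j(q,\beta):=\infty$ otherwise. For $u=(w,p,\alpha)$ and $z=(v,q,\beta)$ in $X$ put $$a(u,z):=(\sigma(w,p),\varepsilon(v)-q)_{L^2(\Omega)}+(\mathbb Hp,q)_{L^2(\Omega)}+(H\alpha,\beta)_{L^2(\Omega)},\quad b(z):=(f,v)_{L^2(\Omega)}+(g,v)_{L^2(\Gamma_N)},\quad \psi(z):=\int_\Omega j(q,\beta)\,dx .$$ **Meshes.** A mesh $\mathcal T$ is a finite conforming decomposition of $\overline\Omega$ into closed triangles ($d=2$) or tetrahedra ($d=3$), each with an order $(x_0,\dots,x_d)$ of its vertices and a type $\gamma\in\{0,\dots,d-1\}$; its reference edge is $x_0x_d$. Bisecting such an element produces, with $m:=\frac12(x_0+x_d)$, the two elements $(x_0,m,x_1,\dots,x_{d-1})$ and $(x_d,m,x_1,\dots,x_\gamma,x_{d-1},\dots,x_{\gamma+1})$, both of type $\gamma+1\bmod d$ (for $d=2$ this is the usual newest vertex bisection of a triangle with a fixed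 reference edge). For $\mathcal M\subset\mathcal T$, the mesh $\operatorname{NVB}(\mathcal T,\mathcal M)$ arises by bisecting all elements of $\mathcal M$ and then repeatedly bisecting all elements that have a hanging node (a vertex of another element in the interior of one of their edges), until there are none and the result is a conforming mesh. $\mathbb T(\mathcal T)$ is the set of all meshes obtained from $\mathcal T$ by finitely many successive such steps. **Discrete solution, error measure, estimator.** $X(\mathcal T)$ is the set of all $(v,q,\beta)\in X$ such that $v$ is affine and $q,\beta$ are constant on each $T\in\mathcal T$. The discrete solution $U(\mathcal T)\in X(\mathcal T)$ satisfies $$b(z-U(\mathcal T))\le a(U(\mathcal T),z-U(\mathcal T))+\psi(z)-\psi(U(\mathcal T))\qquad\text{for all }z\in X(\mathcal T).$$ For $z=(v,q,\beta)$ and $\hat z=(\hat v,\hat q,\hat\beta)$ let $\mathrm d[z,\hat z]:=\|\sigma(v,q)-\sigma(\hat v,\hat q)\|_{L^2(\Omega)}$. For $T\in\mathcal T$ and $z=(v,q,\beta)\in X(\mathcal T)$ let $$\eta_T(\mathcal T;z)^2:=|T|\,\|f\|_{L^2(T)}^2+|T|^{1/2}\sum_{E}R_E(z)^2,$$ where $E$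 runs over the edges ($d=2$) or faces ($d=3$) of $T$, and $R_E(z)$ is $\|[\sigma(v,q)]\nu_E\|_{L^2(E)}$ if $E$ is shared by two elements (with $[\cdot]$ the jump across $E$), $\|g-\sigma(v,q)\nu_E\|_{L^2(E)}$ if $E$ lies on $\Gamma_N$, and $0$ if $E$ lies on $\Gamma_D$; here $\nu_E$ is a unit normal of $E$, the outer one on the boundary. **Lemma (reduction on refined elements).** Let $\mathcal T_0$ be a mesh of $\Omega$ such that the relative interior of each of its boundary edges (faces) lies in $\Gamma_D$ or in $\Gamma_N$. Then there are constants $0<\rho_2<1$ and $C_2>0$ such that $$\sum_{\hat T\in\hat{\mathcal T}\setminus\mathcal T}\eta_{\hat T}(\hat{\mathcal T};U(\hat{\mathcal T}))^2\le\rho_2\sum_{T\in\mathcal T\setminus\hat{\mathcal T}}\eta_T(\mathcal T;U(\mathcal T))^2+C_2\,\mathrm d[U(\hat{\mathcal T}),U(\mathcal T)]^2$$ for all $\mathcal T\in\mathbb T(\mathcal T_0)$ and all $\hat{\mathcal T}\in\mathbb T(\mathcal T)$. -/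

import Mathlib

open MeasureTheory

namespace ElastoAFEM

open Filter Topology
open scoped ContDiff

/-- Points and vectors of `ℝ^d` with the Euclidean norm. -/
abbrev Pt (d : ℕ) := EuclideanSpace ℝ (Fin d)

/-- Tensors of second order. -/
abbrev Mat (d : ℕ) := Matrix (Fin d) (Fin d) ℝ

/-- The scalar product `A : B` of tensors. -/
def ddot {d : ℕ} (A B : Mat d) : ℝ := ∑ i, ∑ j, A i j * B i j

/-- The norm `|A|` of a tensor. -/
noncomputable def matNorm {d : ℕ} (A : Mat d) : ℝ := Real.sqrt (ddot A A)

/-- The vector `A n`. -/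
def matVec {d : ℕ} (A : Mat d) (n : Pt d) : Pt d := WithLp.toLp 2 (Matrix.mulVec A (WithLp.ofLp n))

/-- The surface measure: `(d-1)`-dimensional Hausdorff measure on `ℝ^d`, normalised so that it is
length for `d = 2` and area for `d = 3`. -/
noncomputable def surf (d : ℕ) : Measure (Pt d) := Measure.euclideanHausdorffMeasure (d - 1)

/-! ### Sobolev functions -/

/-- Near each of its boundary points, `Ω` is the strict epigraph of a Lipschitz function in some
orthonormal coordinate system, whose last axis has the direction `e`. -/
def HasLipschitzBoundary {d : ℕ} (Ω : Set (Pt d)) : Prop :=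
  ∀ x ∈ frontier Ω, ∃ e : Pt d, ‖e‖ = 1 ∧ ∃ (L : NNReal) (γ : Pt d → ℝ), LipschitzWith L γ ∧
    ∀ᶠ y in 𝓝 x, (y ∈ Ω ↔ γ (y - inner ℝ e y • e) < inner ℝ e y)

/-- The partial derivative in the `j`-th coordinate direction. -/
noncomputable def partialDeriv {d : ℕ} (φ : Pt d → ℝ) (j : Fin d) (x : Pt d) : ℝ :=
  fderiv ℝ φ x (EuclideanSpace.single j 1)

/-- `G` is the weak gradient of the vector field `v` on `Ω`, `G i j = ∂_j v_i`. -/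
def HasWeakGradient {d : ℕ} (Ω : Set (Pt d)) (v : Pt d → Pt d) (G : Pt d → Mat d) : Prop :=
  ∀ φ : Pt d → ℝ, ContDiff ℝ ∞ φ → HasCompactSupport φ → tsupport φ ⊆ Ω → ∀ i j : Fin d,
    ∫ x in Ω, v x i * partialDeriv φ j x = - ∫ x in Ω, G x i j * φ x

/-- `t` is the trace on `∂Ω` of the `H¹` field `v` with gradient `G`: there are fields, smooth up
to the boundary, that tend to `v` in `H¹(Ω)` and whose boundary values tend to `t` in
`L²(∂Ω)`. -/
def HasTrace {d : ℕ} (Ω : Set (Pt d)) (v : Pt d → Pt d) (G : Pt d → Mat d) (t : Pt d → Pt d) :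
    Prop :=
  ∃ φ : ℕ → Pt d → Pt d, (∀ n, ContDiff ℝ ∞ (φ n)) ∧
    Tendsto (fun n => eLpNorm (fun x => φ n x - v x) 2 (volume.restrict Ω)) atTop (𝓝 0) ∧
    (∀ i j : Fin d, Tendsto
      (fun n => eLpNorm (fun x => partialDeriv (fun y => φ n y i) j x - G x i j) 2
        (volume.restrict Ω)) atTop (𝓝 0)) ∧
    Tendsto (fun n => eLpNorm (fun x => φ n x - t x) 2 ((surf d).restrict (frontier Ω)))
      atTop (𝓝 0)

/-! ### The model problem -/

/-- The data of one time step of the primal problem of elastoplasticity with isotropic and linear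
kinematic hardening. -/
structure Problem (d : ℕ) where
  /-- the reference domain -/
  Ω : Set (Pt d)
  isOpen : IsOpen Ω
  isBounded : Bornology.IsBounded Ω
  lipschitz : HasLipschitzBoundary Ω
  /-- the Dirichlet part of the boundary -/
  ΓD : Set (Pt d)
  ΓD_closed : IsClosed ΓD
  ΓD_subset : ΓD ⊆ frontier Ω
  ΓD_pos : 0 < surf d ΓD
  /-- the body force -/
  f : Pt d → Pt d
  f_memLp : MemLp f 2 (volume.restrict Ω)
  /-- the surface traction, on the Neumann boundary -/
  g : Pt d → Pt d
  g_memLp : MemLp g 2 ((surf d).restrict (frontier Ω \ ΓD))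
  /-- the isotropic elasticity tensor -/
  elast : Mat d →ₗ[ℝ] Mat d
  elast_isSymm : ∀ τ : Mat d, τ.IsSymm → (elast τ).IsSymm
  elast_symm : ∀ τ ρ : Mat d, τ.IsSymm → ρ.IsSymm → ddot (elast τ) ρ = ddot τ (elast ρ)
  elast_isotropic : ∀ R ∈ Matrix.orthogonalGroup (Fin d) ℝ, ∀ τ : Mat d, τ.IsSymm →
    elast (R * τ * R.transpose) = R * elast τ * R.transpose
  elast_coercive : ∃ κ : ℝ, 0 < κ ∧ ∀ τ : Mat d, τ.IsSymm → κ * matNorm τ ^ 2 ≤ ddot (elast τ) τ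
  /-- the hardening tensor; it may depend (boundedly and measurably) on the point -/
  hard : Pt d → Mat d →ₗ[ℝ] Mat d
  hard_memLp : ∀ (τ : Mat d) (i j : Fin d), MemLp (fun x => hard x τ i j) ⊤ (volume.restrict Ω)
  hard_isSymm : ∀ᵐ x ∂volume.restrict Ω, ∀ τ : Mat d, τ.IsSymm → (hard x τ).IsSymm
  hard_symm : ∀ᵐ x ∂volume.restrict Ω, ∀ τ ρ : Mat d, τ.IsSymm → ρ.IsSymm →
    ddot (hard x τ) ρ = ddot τ (hard x ρ)
  hard_coercive : ∃ κ : ℝ, 0 < κ ∧ ∀ᵐ x ∂volume.restrict Ω, ∀ τ : Mat d, τ.IsSymm →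
    κ * matNorm τ ^ 2 ≤ ddot (hard x τ) τ
  /-- the isotropic hardening modulus -/
  hmod : ℝ
  hmod_pos : 0 < hmod
  /-- the yield stress -/
  yield : ℝ
  yield_pos : 0 < yield

/-- A triple `(v, q, β)`; the displacement `v` comes with its weak gradient and its trace. -/
structure Fields (d : ℕ) where
  v : Pt d → Pt d
  grad : Pt d → Mat d
  trace : Pt d → Pt d
  q : Pt d → Mat d
  β : Pt d → ℝ

instance {d : ℕ} : Sub (Fields d) :=
  ⟨fun z y => ⟨z.v - y.v, z.grad - y.grad, z.trace - y.trace, z.q - y.q, z.β - y.β⟩⟩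

/-- The linearised Green tensor `ε(v)`. -/
noncomputable def Fields.strain {d : ℕ} (z : Fields d) (x : Pt d) : Mat d :=
  (1 / 2 : ℝ) • (z.grad x + (z.grad x).transpose)

namespace Problem

variable {d : ℕ} (P : Problem d)

/-- The Neumann part of the boundary. -/
def ΓN : Set (Pt d) := frontier P.Ω \ P.ΓD

/-- The space `X = V × Q × M`: `v ∈ H¹(Ω; ℝ^d)` with `v = 0` on `Γ_D`, `q ∈ L²(Ω)` symmetric and
trace free, `β ∈ L²(Ω)`. -/
structure MemX (z : Fields d) : Prop where
  v_memLp : MemLp z.v 2 (volume.restrict P.Ω)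
  grad_memLp : ∀ i j : Fin d, MemLp (fun x => z.grad x i j) 2 (volume.restrict P.Ω)
  weakGradient : HasWeakGradient P.Ω z.v z.grad
  trace_memLp : MemLp z.trace 2 ((surf d).restrict (frontier P.Ω))
  hasTrace : HasTrace P.Ω z.v z.grad z.trace
  dirichlet : ∀ᵐ x ∂(surf d).restrict P.ΓD, z.trace x = 0
  q_memLp : ∀ i j : Fin d, MemLp (fun x => z.q x i j) 2 (volume.restrict P.Ω)
  q_dev : ∀ᵐ x ∂volume.restrict P.Ω, (z.q x).IsSymm ∧ (z.q x).trace = 0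
  β_memLp : MemLp z.β 2 (volume.restrict P.Ω)

/-- The stress tensor `σ(v, q) = ℂ(ε(v) - q)`. -/
noncomputable def stress (z : Fields d) (x : Pt d) : Mat d := P.elast (z.strain x - z.q x)

/-- The bilinear form `a(u, z)`. -/
noncomputable def a (u z : Fields d) : ℝ :=
  (∫ x in P.Ω, ddot (P.stress u x) (z.strain x - z.q x)) +
    (∫ x in P.Ω, ddot (P.hard x (u.q x)) (z.q x)) + ∫ x in P.Ω, (P.hmod * u.β x) * z.β x

/-- The linear form `b(z)`. -/
noncomputable def b (z : Fields d) : ℝ :=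
  (∫ x in P.Ω, inner ℝ (P.f x) (z.v x)) + ∫ x in P.ΓN, inner ℝ (P.g x) (z.trace x) ∂surf d

open Classical in
/-- The dissipation potential `j(q, β)`. -/
noncomputable def dissipation (q : Mat d) (β : ℝ) : ENNReal :=
  if matNorm q ≤ β then ENNReal.ofReal (P.yield * matNorm q) else ⊤

/-- The functional `ψ(z) = ∫ j(q, β)`, with values in `[0, ∞]`. -/
noncomputable def ψ (z : Fields d) : ENNReal := ∫⁻ x in P.Ω, P.dissipation (z.q x) (z.β x)

/-- The error measure `d[z, y]`, the `L²` norm of the difference of the stresses. -/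
noncomputable def dist (z y : Fields d) : ℝ :=
  Real.sqrt (∫ x in P.Ω, matNorm (P.stress z x - P.stress y x) ^ 2)

end Problem

/-! ### Meshes and newest vertex bisection -/

/-- A simplex with ordered vertices `x_0, …, x_d` and a type `γ ∈ {0, …, d-1}`. Its reference
edge joins `x_0` and `x_d`. -/
structure TSimplex (d : ℕ) where
  vert : Fin (d + 1) → Pt d
  tag : ℕ

noncomputable instance {d : ℕ} : DecidableEq (TSimplex d) := Classical.decEq _

namespace TSimplex

variable {d : ℕ} (K : TSimplex d)

/-- The closed simplex. -/
def carrier : Set (Pt d) := convexHull ℝ (Set.range K.vert)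

/-- The face (an edge if `d = 2`) opposite to the `i`-th vertex. -/
def face (i : Fin (d + 1)) : Set (Pt d) := convexHull ℝ (K.vert '' {i}ᶜ)

/-- The outer unit normal on the face opposite to the `i`-th vertex: the normalised component
of `∑_j (x_j - x_i)` that is orthogonal to the face. -/
noncomputable def normal (i : Fin (d + 1)) : Pt d :=
  let w := ((vectorSpan ℝ (K.vert '' {i}ᶜ))ᗮ).starProjection (∑ j, (K.vert j - K.vert i))
  ‖w‖⁻¹ • w

/-- The newest vertex, the midpoint of the reference edge. -/
noncomputable def newVert : Pt d := midpoint ℝ (K.vert 0) (K.vert (Fin.last d))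

/-- The first child `(x_0, m, x_1, …, x_{d-1})` of type `γ + 1 mod d`, where `m` is the newest
vertex. -/
noncomputable def child₁ : TSimplex d where
  vert i := if i.val = 0 then K.vert 0 else if i.val = 1 then K.newVert
    else K.vert (Fin.ofNat (d + 1) (i.val - 1))
  tag := (K.tag + 1) % d

/-- The second child `(x_d, m, x_1, …, x_γ, x_{d-1}, …, x_{γ+1})` of type `γ + 1 mod d`, where
`m` is the newest vertex. -/
noncomputable def child₂ : TSimplex d where
  vert i := if i.val = 0 then K.vert (Fin.last d) else if i.val = 1 then K.newVert
    else if i.val - 1 ≤ K.tag then K.vert (Fin.ofNat (d + 1) (i.val - 1))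
    else K.vert (Fin.ofNat (d + 1) (d + K.tag - (i.val - 1)))
  tag := (K.tag + 1) % d

end TSimplex

/-- A mesh is a finite set of simplices (with the order of vertices and the type that fix their
bisection). -/
abbrev Mesh (d : ℕ) := Finset (TSimplex d)

namespace Mesh

variable {d : ℕ}

/-- `T` is a conforming decomposition of `Ω`: the elements cover the closure of `Ω`, and two
different elements meet in the simplex spanned by their common vertices (if any), which is not
an element. -/
structure IsMesh (Ω : Set (Pt d)) (T : Mesh d) : Prop where
  affineIndependent : ∀ K ∈ T, AffineIndependent ℝ K.vert
  tag_lt : ∀ K ∈ T, K.tag < d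
  cover : closure Ω = ⋃ K ∈ T, K.carrier
  conforming : ∀ K ∈ T, ∀ K' ∈ T, K ≠ K' → Set.range K.vert ≠ Set.range K'.vert ∧
    K.carrier ∩ K'.carrier = convexHull ℝ (Set.range K.vert ∩ Set.range K'.vert)

/-- Bisection of all elements of `M`. -/
noncomputable def bisect (T M : Mesh d) : Mesh d :=
  (T \ M) ∪ M.biUnion fun K => {K.child₁, K.child₂}

open Classical in
/-- The elements with a hanging node: a vertex of some element lies in the interior of one of
their edges. -/
noncomputable def hanging (T : Mesh d) : Mesh d :=
  T.filter fun K => ∃ K' ∈ T, ∃ i j k : Fin (d + 1), j ≠ k ∧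
    K'.vert i ∈ openSegment ℝ (K.vert j) (K.vert k)

/-- One step of the mesh closure. -/
noncomputable def closureStep (T : Mesh d) : Mesh d := bisect T (hanging T)

/-- `T' = NVB(T, M)`: first the elements of `M` are bisected, then the elements with hanging nodes
until there are none; the result has to be a mesh of `Ω`. -/
def IsNVB (Ω : Set (Pt d)) (T M T' : Mesh d) : Prop :=
  M ⊆ T ∧ (∃ n : ℕ, T' = closureStep^[n] (bisect T M)) ∧ hanging T' = ∅ ∧ IsMesh Ω T'

/-- The set `𝕋(T)` of all meshes that arise from `T` by finitely many successive newest vertex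
bisections. -/
def refinements (Ω : Set (Pt d)) (T : Mesh d) : Set (Mesh d) :=
  {T' | Relation.ReflTransGen (fun S S' => ∃ M, IsNVB Ω S M S') T T'}

/-- The `i`-th face of `K` is an interior face of the mesh: it is shared with another element. -/
def IsInterior (T : Mesh d) (K : TSimplex d) (i : Fin (d + 1)) : Prop :=
  ∃ K' ∈ T, K' ≠ K ∧ ∃ j, K'.face j = K.face i

open Classical in
/-- The elements on the other side of the `i`-th face of `K` (exactly one for an interior face of
a mesh). -/
noncomputable def neighbors (T : Mesh d) (K : TSimplex d) (i : Fin (d + 1)) : Mesh d :=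
  T.filter fun K' => K' ≠ K ∧ ∃ j, K'.face j = K.face i

end Mesh

/-! ### Discrete problem and error estimator -/

namespace Problem

variable {d : ℕ} (P : Problem d)

/-- The mesh resolves the two parts of the boundary: every face that is not an interior one lies
on `Γ_D`, or (up to its relative boundary) on `Γ_N`. -/
def Resolves (T : Mesh d) : Prop :=
  ∀ K ∈ T, ∀ i, ¬ T.IsInterior K i →
    K.face i ⊆ P.ΓD ∨ intrinsicInterior ℝ (K.face i) ⊆ P.ΓN

/-- The discrete space `X(T) ⊆ X`: on each element, `v` is affine and `q`, `β` are constant. -/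
structure MemXh (T : Mesh d) (z : Fields d) : Prop where
  memX : P.MemX z
  v_affine : ∀ K ∈ T, ∃ A : Pt d →ᵃ[ℝ] Pt d, ∀ᵐ x ∂volume.restrict K.carrier, z.v x = A x
  q_const : ∀ K ∈ T, ∃ c : Mat d, c.IsSymm ∧ c.trace = 0 ∧
    ∀ᵐ x ∂volume.restrict K.carrier, z.q x = c
  β_const : ∀ K ∈ T, ∃ c : ℝ, ∀ᵐ x ∂volume.restrict K.carrier, z.β x = c

/-- `U` is the discrete solution `U(T)`. -/
def IsDiscreteSolution (T : Mesh d) (U : Fields d) : Prop :=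
  P.MemXh T U ∧ ∀ z, P.MemXh T z →
    ((P.b (z - U) : ℝ) : EReal) ≤ ((P.a U (z - U) : ℝ) : EReal) + (P.ψ z : EReal) - (P.ψ U : EReal)

/-- The value of the stress on the element `K`, written as its mean value over `K`: the stress
of a discrete function is constant on `K` almost everywhere. -/
noncomputable def stressOn (z : Fields d) (K : TSimplex d) : Mat d :=
  fun i j => ⨍ x in K.carrier, P.stress z x i j

open Classical in
/-- The square `R_E(z)²` for the `i`-th face `E` of the element `K`: the squared `L²(E)` norm of
the jump of the normal stress on an interior face, of `g - σ ν` on a Neumann face, and zero on a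
Dirichlet face. -/
noncomputable def residualSq (T : Mesh d) (z : Fields d) (K : TSimplex d) (i : Fin (d + 1)) : ℝ :=
  if T.IsInterior K i then
    ∑ K' ∈ T.neighbors K i, ∫ _x in K.face i,
      ‖matVec (P.stressOn z K - P.stressOn z K') (K.normal i)‖ ^ 2 ∂surf d
  else if intrinsicInterior ℝ (K.face i) ⊆ P.ΓN then
    ∫ x in K.face i, ‖P.g x - matVec (P.stressOn z K) (K.normal i)‖ ^ 2 ∂surf d
  else 0

/-- The squared refinement indicator `η_K(T; z)²`. -/
noncomputable def etaSq (T : Mesh d) (z : Fields d) (K : TSimplex d) : ℝ :=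
  volume.real K.carrier * (∫ x in K.carrier, ‖P.f x‖ ^ 2) +
    Real.sqrt (volume.real K.carrier) * ∑ i, P.residualSq T z K i

end Problem

end ElastoAFEM

open ElastoAFEM

/-!
The estimator decreases on refined elements for two reasons. Bisection halves the volume, which
occurs as a factor of the volume term and, under a square root, of the residuals; and the stress of
the coarse solution is constant on each coarse element, so that it does not jump across the new
faces inside of it. Let `K'` be a new element of the fine mesh and `K` the coarse element that
contains it. Up to differences between the fine and the coarse stress, the residual on a face of
`K'` is zero if the face crosses the interior of `K`, and is the restriction of the residual of `K`
otherwise (`Problem.residualSq_le`). Faces of fine elements overlap only in null sets of the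
surface measure, hence these restrictions add up to at most the residuals of `K`
(`Problem.sum_coarseResidual_le`). Young's inequality with the factor `5/4` and
`5/4 * √(1/2) < 9/10` give the reduction by `9/10`. The differences of the stresses are constant on
fine elements, so their norms on a face are bounded by their norms on the adjacent elements, by the
shape regularity of newest vertex bisection (`exists_sqrt_volume_mul_surf_le`); only finitely many
of them overlap, and the sum is bounded by the error measure
(`Problem.sum_volume_mul_le_dist_sq`).

The geometry is expressed in barycentric coordinates: an affine function that vanishes on a face of
a simplex is a multiple of the opposite coordinate. This determines when faces of different meshes
lie in each other, and shows that outer normals are preserved under inclusion and are opposite for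
two neighbours. A face of the fine mesh that no other fine element shares lies in a boundary face of
the coarse mesh (`Mesh.IsMesh.exists_boundary_face`), because near its centroid the domain is
covered by a single element.

Shape regularity follows from an invariant of the bisection: all descendants of a simplex are images
of Kuhn simplices (or of their descendants up to the next generation) whose edge vectors arise from
fixed ones by reversal and by halving every `d` generations (`TSimplex.IsDescendant.isKuhn`).

Since a Lipschitz domain is the interior of its closure, almost every point of an element lies in
the domain, and the weak gradient of a piecewise affine field is piecewise constant there; this is
why the stress is constant on each element (`Problem.stress_ae_eq`).
-/

namespace ElastoAFEM

open Filter Topology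
open scoped ContDiff

/-! ### Barycentric coordinates -/

namespace TSimplex

variable {d : ℕ}

/-- The vertices of a nondegenerate simplex as an affine basis; its coordinates are the
barycentric coordinates of the simplex. -/
noncomputable def bary (K : TSimplex d) (h : AffineIndependent ℝ K.vert) :
    AffineBasis (Fin (d + 1)) ℝ (Pt d) where
  toFun := K.vert
  ind' := h
  tot' := by
    rw [h.affineSpan_eq_top_iff_card_eq_finrank_add_one]
    simp

@[simp] lemma bary_apply (K : TSimplex d) (h : AffineIndependent ℝ K.vert) (i : Fin (d + 1)) :
    K.bary h i = K.vert i := rfl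

lemma coe_bary (K : TSimplex d) (h : AffineIndependent ℝ K.vert) : ⇑(K.bary h) = K.vert := rfl

end TSimplex

section AffineBasis

variable {ι E : Type*} [Fintype ι] [AddCommGroup E] [Module ℝ E]

lemma affineMap_apply_eq_sum {F : Type*} [AddCommGroup F] [Module ℝ F]
    (b : AffineBasis ι ℝ E) (φ : E →ᵃ[ℝ] F) (x : E) :
    φ x = ∑ i, b.coord i x • φ (b i) := by
  conv_lhs => rw [← b.affineCombination_coord_eq_self x]
  rw [Finset.univ.map_affineCombination _ _ (b.sum_coord_apply_eq_one x),
    Finset.affineCombination_eq_linear_combination _ _ _ (b.sum_coord_apply_eq_one x)]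
  rfl

/-- The points of a subface of a simplex are those with nonnegative barycentric coordinates that
vanish at the remaining vertices. -/
lemma mem_convexHull_image_iff (b : AffineBasis ι ℝ E) (S : Set ι) (x : E) :
    x ∈ convexHull ℝ (b '' S) ↔ (∀ i, 0 ≤ b.coord i x) ∧ ∀ i ∉ S, b.coord i x = 0 := by
  classical
  constructor
  · intro hx
    constructor
    · have : x ∈ convexHull ℝ (Set.range b) := convexHull_mono (Set.image_subset_range _ _) hx
      rwa [b.convexHull_eq_nonneg_coord] at this
    · intro i hi
      have hc : Convex ℝ {y | b.coord i y = 0} :=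
        (convex_singleton (0 : ℝ)).affine_preimage (b.coord i)
      refine convexHull_min ?_ hc hx
      rintro _ ⟨j, hj, rfl⟩
      exact b.coord_apply_ne (fun h => hi (h ▸ hj))
  · rintro ⟨h0, hS⟩
    rw [← b.linear_combination_coord_eq_self x,
      ← Finset.sum_subset (Finset.subset_univ (Finset.univ.filter (· ∈ S)))
        (fun i _ hi => by rw [hS i (by simpa using hi), zero_smul])]
    refine (convex_convexHull ℝ _).sum_mem (fun i _ => h0 i) ?_ (fun i hi => ?_)
    · rw [Finset.sum_subset (Finset.subset_univ _)
        (fun i _ hi => hS i (by simpa using hi)), b.sum_coord_apply_eq_one]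
    · exact subset_convexHull ℝ _ ⟨i, by simpa using hi, rfl⟩

/-- An affine function that vanishes at all vertices but one is a multiple of a barycentric
coordinate. -/
lemma affineMap_eq_mul_coord (b : AffineBasis ι ℝ E) (φ : E →ᵃ[ℝ] ℝ) (i : ι)
    (h : ∀ j ≠ i, φ (b j) = 0) (x : E) : φ x = φ (b i) * b.coord i x := by
  rw [affineMap_apply_eq_sum b φ x, Finset.sum_eq_single i]
  · simp [mul_comm]
  · intro j _ hj; simp [h j hj]
  · simp

end AffineBasis

namespace TSimplex

variable {d : ℕ}

lemma mem_carrier_iff {K : TSimplex d} (h : AffineIndependent ℝ K.vert) {x : Pt d} :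
    x ∈ K.carrier ↔ ∀ i, 0 ≤ (K.bary h).coord i x := by
  have := (K.bary h).convexHull_eq_nonneg_coord
  rw [coe_bary] at this
  rw [carrier, this]; rfl

lemma mem_interior_carrier_iff {K : TSimplex d} (h : AffineIndependent ℝ K.vert) {x : Pt d} :
    x ∈ interior K.carrier ↔ ∀ i, 0 < (K.bary h).coord i x := by
  have := (K.bary h).interior_convexHull
  rw [coe_bary] at this
  rw [carrier, this]; rfl

lemma mem_convexHull_vert_iff {K : TSimplex d} (h : AffineIndependent ℝ K.vert)
    {S : Set (Fin (d + 1))} {x : Pt d} : x ∈ convexHull ℝ (K.vert '' S) ↔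
      (∀ i, 0 ≤ (K.bary h).coord i x) ∧ ∀ i ∉ S, (K.bary h).coord i x = 0 :=
  mem_convexHull_image_iff (K.bary h) S x

lemma mem_face_iff {K : TSimplex d} (h : AffineIndependent ℝ K.vert) {i : Fin (d + 1)}
    {x : Pt d} : x ∈ K.face i ↔ (∀ j, 0 ≤ (K.bary h).coord j x) ∧ (K.bary h).coord i x = 0 := by
  rw [face, mem_convexHull_vert_iff h]; simp

lemma face_subset_carrier (K : TSimplex d) (i : Fin (d + 1)) : K.face i ⊆ K.carrier :=
  convexHull_mono (Set.image_subset_range _ _)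

lemma vert_mem_carrier (K : TSimplex d) (i : Fin (d + 1)) : K.vert i ∈ K.carrier :=
  subset_convexHull ℝ _ ⟨i, rfl⟩

lemma vert_mem_face (K : TSimplex d) {i j : Fin (d + 1)} (h : j ≠ i) : K.vert j ∈ K.face i :=
  subset_convexHull ℝ _ ⟨j, h, rfl⟩

lemma isCompact_carrier (K : TSimplex d) : IsCompact K.carrier :=
  (Set.finite_range _).isCompact_convexHull ℝ

lemma isCompact_face (K : TSimplex d) (i : Fin (d + 1)) : IsCompact (K.face i) :=
  ((Set.toFinite _).image _).isCompact_convexHull ℝ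

lemma convex_carrier (K : TSimplex d) : Convex ℝ K.carrier := convex_convexHull ℝ _

lemma convex_face (K : TSimplex d) (i : Fin (d + 1)) : Convex ℝ (K.face i) := convex_convexHull ℝ _

lemma coord_vert {K : TSimplex d} (h : AffineIndependent ℝ K.vert) (i j : Fin (d + 1)) :
    (K.bary h).coord i (K.vert j) = if i = j then 1 else 0 :=
  (K.bary h).coord_apply i j

/-- The centroid of the face opposite to the `i`-th vertex. -/
noncomputable def faceCenter (K : TSimplex d) (i : Fin (d + 1)) : Pt d :=
  ∑ j, (if j = i then (0 : ℝ) else (d : ℝ)⁻¹) • K.vert j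

lemma sum_faceWeights (hd : 0 < d) (i : Fin (d + 1)) :
    ∑ j, (if j = i then (0 : ℝ) else (d : ℝ)⁻¹) = 1 := by
  have hd' : (d : ℝ) ≠ 0 := by positivity
  simp [Finset.sum_ite, Finset.filter_ne', hd']

lemma affineMap_faceCenter (hd : 0 < d) (K : TSimplex d) (i : Fin (d + 1))
    {F : Type*} [AddCommGroup F] [Module ℝ F] (φ : Pt d →ᵃ[ℝ] F) :
    φ (K.faceCenter i) = ∑ j, (if j = i then (0 : ℝ) else (d : ℝ)⁻¹) • φ (K.vert j) := by
  have h := sum_faceWeights hd i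
  rw [faceCenter, ← Finset.affineCombination_eq_linear_combination _ _ _ h,
    Finset.univ.map_affineCombination _ _ h, Finset.affineCombination_eq_linear_combination _ _ _ h]
  rfl

lemma coord_faceCenter (hd : 0 < d) {K : TSimplex d} (h : AffineIndependent ℝ K.vert)
    (i j : Fin (d + 1)) :
    (K.bary h).coord j (K.faceCenter i) = if j = i then 0 else (d : ℝ)⁻¹ := by
  rw [affineMap_faceCenter hd, Finset.sum_eq_single j]
  · simp [coord_vert]
  · intro k _ hk; simp [coord_vert, hk.symm]
  · simp

lemma faceCenter_mem_face (hd : 0 < d) {K : TSimplex d} (h : AffineIndependent ℝ K.vert)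
    (i : Fin (d + 1)) : K.faceCenter i ∈ K.face i := by
  rw [mem_face_iff h]
  refine ⟨fun j => ?_, ?_⟩ <;> rw [coord_faceCenter hd]
  · split_ifs <;> positivity
  · simp

lemma interior_carrier_nonempty (K : TSimplex d) (h : AffineIndependent ℝ K.vert) :
    (interior K.carrier).Nonempty := by
  rw [carrier, interior_convexHull_nonempty_iff_affineSpan_eq_top]
  exact (K.bary h).tot

lemma interior_face_eq_empty {K : TSimplex d} (h : AffineIndependent ℝ K.vert) (i : Fin (d + 1)) :
    interior (K.face i) = ∅ := by
  by_contra hne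
  obtain ⟨x, hx⟩ := Set.nonempty_iff_ne_empty.mpr hne
  have h1 := (mem_interior_carrier_iff h).1 (interior_mono (K.face_subset_carrier i) hx) i
  have h2 := ((mem_face_iff h).1 (interior_subset hx)).2
  exact h1.ne' h2

lemma faceCenter_notMem_interior (hd : 0 < d) {K : TSimplex d} (h : AffineIndependent ℝ K.vert)
    (i : Fin (d + 1)) : K.faceCenter i ∉ interior K.carrier := fun hx => by
  have := (mem_interior_carrier_iff h).1 hx i
  rw [coord_faceCenter hd] at this
  simp at this

/-- An affine function that vanishes on a face is a multiple of the opposite barycentric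
coordinate. -/
lemma affineMap_eq_mul_coord_of_face {K : TSimplex d} (h : AffineIndependent ℝ K.vert)
    {i : Fin (d + 1)} (φ : Pt d →ᵃ[ℝ] ℝ) (hφ : ∀ x ∈ K.face i, φ x = 0) (x : Pt d) :
    φ x = φ (K.vert i) * (K.bary h).coord i x :=
  affineMap_eq_mul_coord (K.bary h) φ i (fun _ hj => hφ _ (K.vert_mem_face hj)) x

/-- An affine function that is nonnegative on a face and vanishes at its centroid vanishes on the
whole face. -/
lemma eq_zero_on_face_of_faceCenter (hd : 0 < d) {K : TSimplex d} {i : Fin (d + 1)}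
    (φ : Pt d →ᵃ[ℝ] ℝ) (h0 : ∀ j ≠ i, 0 ≤ φ (K.vert j)) (hc : φ (K.faceCenter i) = 0) :
    ∀ x ∈ K.face i, φ x = 0 := by
  have hd' : (0 : ℝ) < (d : ℝ)⁻¹ := by positivity
  rw [affineMap_faceCenter hd, Finset.sum_eq_zero_iff_of_nonneg] at hc
  · refine convexHull_min ?_ ((convex_singleton (0 : ℝ)).affine_preimage φ)
    rintro _ ⟨j, hj, rfl⟩
    have hj : j ≠ i := hj
    have := hc j (Finset.mem_univ _)
    rw [if_neg hj, smul_eq_mul, mul_eq_zero] at this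
    exact this.resolve_left hd'.ne'
  · intro j _
    split_ifs with hj
    · simp
    · exact smul_nonneg hd'.le (h0 j hj)

/-! ### Normals -/

/-- The gradient of the `i`-th barycentric coordinate. -/
noncomputable def coordGrad (K : TSimplex d) (h : AffineIndependent ℝ K.vert) (i : Fin (d + 1)) :
    Pt d :=
  (InnerProductSpace.toDual ℝ (Pt d)).symm (LinearMap.toContinuousLinearMap
    ((K.bary h).coord i).linear)

lemma inner_coordGrad {K : TSimplex d} (h : AffineIndependent ℝ K.vert) (i : Fin (d + 1))
    (x : Pt d) : inner ℝ (K.coordGrad h i) x = ((K.bary h).coord i).linear x := by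
  simp [coordGrad]

lemma coord_linear_sub {K : TSimplex d} (h : AffineIndependent ℝ K.vert) (i : Fin (d + 1))
    (x y : Pt d) : ((K.bary h).coord i).linear (x - y) =
      (K.bary h).coord i x - (K.bary h).coord i y := by
  rw [← vsub_eq_sub x y, AffineMap.linearMap_vsub, vsub_eq_sub]

lemma coordGrad_ne_zero (hd : 0 < d) {K : TSimplex d} (h : AffineIndependent ℝ K.vert)
    (i : Fin (d + 1)) : K.coordGrad h i ≠ 0 := by
  intro h0
  have : Nontrivial (Fin (d + 1)) := Fin.nontrivial_iff_two_le.2 (by omega)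
  obtain ⟨j, hj⟩ := exists_ne i
  have := inner_coordGrad h i (K.vert i - K.vert j)
  rw [h0, inner_zero_left, coord_linear_sub, coord_vert, coord_vert] at this
  simp [hj.symm] at this

/-- The outer normal is the normalised negative gradient of the barycentric coordinate. -/
lemma normal_eq (hd : 0 < d) {K : TSimplex d} (h : AffineIndependent ℝ K.vert)
    (i : Fin (d + 1)) : K.normal i = -(‖K.coordGrad h i‖⁻¹ • K.coordGrad h i) := by
  set g := K.coordGrad h i with hg
  have hg0 : g ≠ 0 := coordGrad_ne_zero hd h i
  have hn : 0 < ‖g‖ := norm_pos_iff.2 hg0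
  have hd' : (0 : ℝ) < d := by exact_mod_cast hd
  have : Nontrivial (Fin (d + 1)) := Fin.nontrivial_iff_two_le.2 (by omega)
  obtain ⟨j₀, hj₀⟩ := exists_ne i
  set U := vectorSpan ℝ (K.vert '' {i}ᶜ) with hU
  -- The direction of the face is the kernel of the linear part of the barycentric coordinate.
  have hmem : ∀ x : Pt d, inner ℝ g x = 0 → x ∈ U := by
    intro x hx
    rw [inner_coordGrad] at hx
    have hc : (K.bary h).coord i (K.vert j₀ + x) = 0 := by
      have := coord_linear_sub h i (K.vert j₀ + x) (K.vert j₀)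
      rw [add_sub_cancel_left, hx, coord_vert, if_neg hj₀.symm, sub_zero] at this
      exact this.symm
    have hs := (K.bary h).linear_combination_coord_eq_self (K.vert j₀ + x)
    have hx' : x = ∑ j, (K.bary h).coord j (K.vert j₀ + x) • (K.vert j - K.vert j₀) := by
      simp only [smul_sub, Finset.sum_sub_distrib, ← Finset.sum_smul,
        (K.bary h).sum_coord_apply_eq_one]
      simp only [bary_apply] at hs
      rw [hs]; simp
    rw [hx']
    refine Submodule.sum_mem _ fun j _ => ?_
    by_cases hj : j = i
    · rw [hj, hc, zero_smul]; exact Submodule.zero_mem _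
    · exact Submodule.smul_mem _ _ (vsub_mem_vectorSpan ℝ ⟨j, hj, rfl⟩ ⟨j₀, hj₀, rfl⟩)
  have horth : g ∈ Uᗮ := by
    rw [Submodule.mem_orthogonal']
    intro u hu
    rw [hU, vectorSpan_def] at hu
    refine Submodule.span_induction (p := fun u _ => inner ℝ g u = 0) ?_ (by simp) ?_ ?_ hu
    · rintro _ ⟨_, ⟨j, hj, rfl⟩, _, ⟨k, hk, rfl⟩, rfl⟩
      have hj : i ≠ j := fun e => hj e.symm
      have hk : i ≠ k := fun e => hk e.symm
      simp only [vsub_eq_sub]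
      rw [inner_coordGrad, coord_linear_sub, coord_vert, coord_vert]; simp [hj, hk]
    · intro x y _ _ hx hy; rw [inner_add_right, hx, hy, add_zero]
    · intro a x _ hx; rw [inner_smul_right, hx, mul_zero]
  have hsum : inner ℝ g (∑ j, (K.vert j - K.vert i)) = -(d : ℝ) := by
    simp only [inner_sum]
    simp only [hg, inner_coordGrad, coord_linear_sub, coord_vert]
    rw [Finset.sum_sub_distrib]
    simp
  have hproj : Uᗮ.starProjection (∑ j, (K.vert j - K.vert i)) = (-(d : ℝ) / ‖g‖ ^ 2) • g := by
    refine Submodule.eq_starProjection_of_mem_orthogonal (Submodule.smul_mem _ _ horth) ?_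
    rw [Submodule.orthogonal_orthogonal]
    refine hmem _ ?_
    rw [inner_sub_right, hsum, inner_smul_right, real_inner_self_eq_norm_sq]
    field_simp; ring
  have hw : K.normal i = ‖Uᗮ.starProjection (∑ j, (K.vert j - K.vert i))‖⁻¹ •
      Uᗮ.starProjection (∑ j, (K.vert j - K.vert i)) := rfl
  rw [hw, hproj, norm_smul, smul_smul, ← neg_smul]
  congr 1
  rw [Real.norm_eq_abs, abs_div, abs_neg, abs_of_pos hd', abs_of_pos (by positivity)]
  field_simp

lemma norm_normal (hd : 0 < d) {K : TSimplex d} (h : AffineIndependent ℝ K.vert)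
    (i : Fin (d + 1)) : ‖K.normal i‖ = 1 := by
  have := norm_pos_iff.2 (coordGrad_ne_zero hd h i)
  rw [normal_eq hd h, norm_neg, norm_smul, norm_inv, norm_norm, inv_mul_cancel₀ this.ne']

lemma coordGrad_eq_smul {K N : TSimplex d} (hK : AffineIndependent ℝ K.vert)
    (hN : AffineIndependent ℝ N.vert) {i j : Fin (d + 1)} {t : ℝ}
    (h : ∀ x, (N.bary hN).coord j x = t * (K.bary hK).coord i x) :
    N.coordGrad hN j = t • K.coordGrad hK i := by
  refine ext_inner_right ℝ fun x => ?_
  rw [real_inner_smul_left, inner_coordGrad, inner_coordGrad, ← sub_zero x, coord_linear_sub,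
    coord_linear_sub, h, h]
  ring

lemma normal_eq_of_pos (hd : 0 < d) {K N : TSimplex d} (hK : AffineIndependent ℝ K.vert)
    (hN : AffineIndependent ℝ N.vert) {i j : Fin (d + 1)} {t : ℝ} (ht : 0 < t)
    (h : ∀ x, (N.bary hN).coord j x = t * (K.bary hK).coord i x) :
    N.normal j = K.normal i := by
  rw [normal_eq hd hK, normal_eq hd hN, coordGrad_eq_smul hK hN h, norm_smul, Real.norm_eq_abs,
    abs_of_pos ht, smul_smul]
  congr 2
  field_simp

lemma normal_eq_neg_of_neg (hd : 0 < d) {K N : TSimplex d} (hK : AffineIndependent ℝ K.vert)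
    (hN : AffineIndependent ℝ N.vert) {i j : Fin (d + 1)} {t : ℝ} (ht : t < 0)
    (h : ∀ x, (N.bary hN).coord j x = t * (K.bary hK).coord i x) :
    N.normal j = -K.normal i := by
  rw [normal_eq hd hK, normal_eq hd hN, coordGrad_eq_smul hK hN h, norm_smul, Real.norm_eq_abs,
    abs_of_neg ht, smul_smul, neg_neg, ← neg_smul]
  congr 1
  have := ht.ne
  field_simp

lemma coord_vert_ne_zero {K N : TSimplex d} (hK : AffineIndependent ℝ K.vert)
    (hN : AffineIndependent ℝ N.vert) {i j : Fin (d + 1)}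
    (hE : ∀ x ∈ K.face i, (N.bary hN).coord j x = 0) :
    (N.bary hN).coord j (K.vert i) ≠ 0 := by
  intro h0
  have := affineMap_eq_mul_coord_of_face hK _ hE (N.vert j)
  rw [h0, coord_vert] at this
  simp at this

/-- A subsimplex has the same outer normal as the surrounding simplex on a face that lies in
a face of the latter. -/
lemma normal_eq_of_subset (hd : 0 < d) {K N : TSimplex d} (hK : AffineIndependent ℝ K.vert)
    (hN : AffineIndependent ℝ N.vert) {i j : Fin (d + 1)} (hKN : K.carrier ⊆ N.carrier)
    (hE : K.face i ⊆ N.face j) : K.normal i = N.normal j := by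
  have hE' : ∀ x ∈ K.face i, (N.bary hN).coord j x = 0 := fun x hx =>
    ((mem_face_iff hN).1 (hE hx)).2
  refine (normal_eq_of_pos hd hK hN ?_ (affineMap_eq_mul_coord_of_face hK _ hE')).symm
  exact lt_of_le_of_ne ((mem_carrier_iff hN).1 (hKN (K.vert_mem_carrier i)) j)
    (coord_vert_ne_zero hK hN hE').symm

end TSimplex

/-! ### Faces and their relative interiors -/

namespace TSimplex

variable {d : ℕ}

lemma mem_affineSpan_face_iff {K : TSimplex d} (h : AffineIndependent ℝ K.vert) {i : Fin (d + 1)}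
    {x : Pt d} : x ∈ affineSpan ℝ (K.face i) ↔ (K.bary h).coord i x = 0 := by
  constructor
  · intro hx
    have hle : affineSpan ℝ (K.face i) ≤
        (AffineSubspace.mk' (0 : ℝ) ⊥).comap ((K.bary h).coord i) := by
      rw [affineSpan_le]
      intro y hy
      simp [((mem_face_iff h).1 hy).2]
    simpa using hle hx
  · intro hx
    have hs := (K.bary h).affineCombination_coord_eq_self x
    have h1 := (K.bary h).sum_coord_apply_eq_one x
    rw [← hs]
    refine affineSpan_mono ℝ (subset_convexHull ℝ _)
      (affineCombination_mem_affineSpan_image h1 (s' := {i}ᶜ) ?_ _)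
    intro j _ hj
    have : j = i := by simpa using hj
    rw [this, hx]

lemma mem_intrinsicInterior_face {K : TSimplex d} (h : AffineIndependent ℝ K.vert)
    {i : Fin (d + 1)} {x : Pt d} (hi : (K.bary h).coord i x = 0)
    (hpos : ∀ j ≠ i, 0 < (K.bary h).coord j x) : x ∈ intrinsicInterior ℝ (K.face i) := by
  rw [mem_intrinsicInterior]
  refine ⟨⟨x, (mem_affineSpan_face_iff h).2 hi⟩, ?_, rfl⟩
  rw [mem_interior]
  refine ⟨⋂ j : {j // j ≠ i}, {z | 0 < (K.bary h).coord j (z : Pt d)}, ?_, ?_, ?_⟩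
  · intro z hz
    simp only [Set.mem_iInter, Set.mem_ofPred_eq] at hz
    have hzi := (mem_affineSpan_face_iff h).1 z.2
    refine (mem_face_iff h).2 ⟨fun j => ?_, hzi⟩
    by_cases hj : j = i
    · rw [hj, hzi]
    · exact (hz ⟨j, hj⟩).le
  · refine isOpen_iInter_of_finite fun j => ?_
    exact isOpen_lt continuous_const
      (((K.bary h).coord j).continuous_of_finiteDimensional.comp continuous_subtype_val)
  · simp only [Set.mem_iInter, Set.mem_ofPred_eq]
    exact fun j => hpos j j.2

lemma faceCenter_mem_intrinsicInterior (hd : 0 < d) {K : TSimplex d}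
    (h : AffineIndependent ℝ K.vert) (i : Fin (d + 1)) :
    K.faceCenter i ∈ intrinsicInterior ℝ (K.face i) := by
  refine mem_intrinsicInterior_face h (by simp [coord_faceCenter hd]) fun j hj => ?_
  rw [coord_faceCenter hd, if_neg hj]
  positivity

lemma intrinsicInterior_face_mono {K N : TSimplex d} (hK : AffineIndependent ℝ K.vert)
    (hN : AffineIndependent ℝ N.vert) {i j : Fin (d + 1)} (hE : K.face i ⊆ N.face j) :
    intrinsicInterior ℝ (K.face i) ⊆ intrinsicInterior ℝ (N.face j) := by
  have hE' : ∀ x ∈ K.face i, (N.bary hN).coord j x = 0 := fun x hx =>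
    ((mem_face_iff hN).1 (hE hx)).2
  have hspan : affineSpan ℝ (K.face i) = affineSpan ℝ (N.face j) := by
    ext x
    rw [mem_affineSpan_face_iff hK, mem_affineSpan_face_iff hN,
      affineMap_eq_mul_coord_of_face hK _ hE', mul_eq_zero]
    simp [coord_vert_ne_zero hK hN hE']
  intro x hx
  rw [mem_intrinsicInterior] at hx ⊢
  obtain ⟨y, hy, rfl⟩ := hx
  rw [mem_interior_iff_mem_nhds, nhds_subtype_eq_comap, mem_comap] at hy
  obtain ⟨t, ht, hts⟩ := hy
  refine ⟨⟨y, (SetLike.ext_iff.1 hspan (y : Pt d)).1 y.2⟩, ?_, rfl⟩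
  rw [mem_interior_iff_mem_nhds, nhds_subtype_eq_comap, mem_comap]
  refine ⟨t, ht, fun z hz => hE ?_⟩
  exact hts (a := ⟨z, (SetLike.ext_iff.1 hspan (z : Pt d)).2 z.2⟩) hz

/-- The part of a face outside its relative interior consists of its lower-dimensional subfaces. -/
lemma face_diff_intrinsicInterior_subset {K : TSimplex d} (h : AffineIndependent ℝ K.vert)
    (i : Fin (d + 1)) : K.face i \ intrinsicInterior ℝ (K.face i) ⊆
      ⋃ j : {j // j ≠ i}, convexHull ℝ (K.vert '' {i, j.1}ᶜ) := by
  rintro x ⟨hx, hxi⟩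
  rw [mem_face_iff h] at hx
  by_contra hn
  refine hxi (mem_intrinsicInterior_face h hx.2 fun j hj => lt_of_le_of_ne (hx.1 j) fun h0 => ?_)
  refine hn (Set.mem_iUnion.2 ⟨⟨j, hj⟩, (mem_convexHull_vert_iff h).2 ⟨hx.1, fun k hk => ?_⟩⟩)
  simp only [Set.mem_compl_iff, Set.mem_insert_iff, Set.mem_singleton_iff, not_not] at hk
  rcases hk with rfl | rfl
  · exact hx.2
  · exact h0.symm

/-- A set of vertices that contains a face of `K` and consists of vertices of `N` spans a face
of `N`. -/
lemma exists_face_eq {K N : TSimplex d} (hK : AffineIndependent ℝ K.vert)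
    (hN : AffineIndependent ℝ N.vert) {i : Fin (d + 1)}
    (h : K.vert '' {i}ᶜ ⊆ Set.range N.vert) : ∃ j, N.vert '' {j}ᶜ = K.vert '' {i}ᶜ := by
  set R := N.vert ⁻¹' (K.vert '' {i}ᶜ) with hR
  have himg : N.vert '' R = K.vert '' {i}ᶜ := Set.image_preimage_eq_of_subset h
  have hc : R.ncard = d := by
    rw [← Set.ncard_image_of_injective R hN.injective, himg,
      Set.ncard_image_of_injective _ hK.injective, Set.ncard_compl]
    simp
  have hc' : Rᶜ.ncard = 1 := by
    rw [Set.ncard_compl, hc]; simp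
  obtain ⟨j, hj⟩ := Set.ncard_eq_one.1 hc'
  exact ⟨j, by rw [← hj, compl_compl, himg]⟩

end TSimplex

/-! ### Conforming meshes -/

namespace Mesh.IsMesh

open TSimplex

variable {d : ℕ} {Ω : Set (Pt d)} {T : Mesh d}

lemma exists_inter_eq (hT : IsMesh Ω T) {K N : TSimplex d} (hK : K ∈ T) (hN : N ∈ T)
    (hne : K ≠ N) : ∃ S : Set (Fin (d + 1)), S ≠ Set.univ ∧
      K.carrier ∩ N.carrier = convexHull ℝ (K.vert '' S) ∧ K.vert '' S ⊆ Set.range N.vert := by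
  obtain ⟨hr, hi⟩ := hT.conforming K hK N hN hne
  have hKi := (hT.affineIndependent K hK).injective
  have hNi := (hT.affineIndependent N hN).injective
  refine ⟨K.vert ⁻¹' Set.range N.vert, fun hS => hr ?_, ?_, ?_⟩
  · have hsub : Set.range K.vert ⊆ Set.range N.vert := by
      rintro _ ⟨i, rfl⟩
      exact Set.eq_univ_iff_forall.1 hS i
    refine Set.eq_of_subset_of_ncard_le hsub ?_ (Set.finite_range _)
    rw [← Set.image_univ, ← Set.image_univ, Set.ncard_image_of_injective _ hKi,
      Set.ncard_image_of_injective _ hNi]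
  · rw [hi, Set.image_preimage_eq_range_inter]
  · exact Set.image_preimage_subset _ _

lemma exists_inter_subset_face (hT : IsMesh Ω T) {K N : TSimplex d} (hK : K ∈ T) (hN : N ∈ T)
    (hne : K ≠ N) : ∃ i, K.carrier ∩ N.carrier ⊆ K.face i := by
  obtain ⟨S, hS, h, -⟩ := hT.exists_inter_eq hK hN hne
  obtain ⟨i, hi⟩ := (Set.ne_univ_iff_exists_notMem S).1 hS
  refine ⟨i, h ▸ convexHull_mono (Set.image_mono ?_)⟩
  rintro j hj rfl
  exact hi hj

lemma eq_of_interior_nonempty (hT : IsMesh Ω T) {K N : TSimplex d} (hK : K ∈ T) (hN : N ∈ T)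
    (h : (interior (K.carrier ∩ N.carrier)).Nonempty) : K = N := by
  by_contra hne
  obtain ⟨i, hi⟩ := hT.exists_inter_subset_face hK hN hne
  have := h.mono (interior_mono hi)
  rw [interior_face_eq_empty (hT.affineIndependent K hK)] at this
  exact this.ne_empty rfl

lemma eq_of_subset (hT : IsMesh Ω T) {K N : TSimplex d} (hK : K ∈ T) (hN : N ∈ T)
    (h : K.carrier ⊆ N.carrier) : K = N := by
  refine hT.eq_of_interior_nonempty hK hN ?_
  rw [Set.inter_eq_left.2 h]
  exact K.interior_carrier_nonempty (hT.affineIndependent K hK)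

/-- A face of some simplex that lies in two different elements lies in a common face of them. -/
lemma exists_common_face (hT : IsMesh Ω T) {K N : TSimplex d} (hK : K ∈ T) (hN : N ∈ T)
    (hne : K ≠ N) {L : TSimplex d} (hL : AffineIndependent ℝ L.vert) {l : Fin (d + 1)}
    (hl : L.face l ⊆ K.carrier ∩ N.carrier) :
    ∃ i j, N.vert '' {j}ᶜ = K.vert '' {i}ᶜ ∧ L.face l ⊆ K.face i := by
  have hKa := hT.affineIndependent K hK
  obtain ⟨S, hS, h, hSN⟩ := hT.exists_inter_eq hK hN hne
  obtain ⟨i, hi⟩ := (Set.ne_univ_iff_exists_notMem S).1 hS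
  have hz : ∀ k ∉ S, ∀ x ∈ L.face l, (K.bary hKa).coord k x = 0 := fun k hk x hx =>
    ((mem_convexHull_vert_iff hKa).1 (h ▸ hl hx)).2 k hk
  -- Two different barycentric coordinates are not proportional, so at most one vanishes on a face.
  have hS' : {i}ᶜ ⊆ S := by
    intro k hk
    by_contra hkS
    have hki : k ≠ i := hk
    have h1 := affineMap_eq_mul_coord_of_face hL _ (hz i hi) (K.vert i)
    have h2 := affineMap_eq_mul_coord_of_face hL _ (hz k hkS) (K.vert i)
    rw [coord_vert] at h1 h2
    simp only [if_true, if_neg hki] at h1 h2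
    rcases mul_eq_zero.1 h2.symm with h3 | h3
    · exact coord_vert_ne_zero hL hKa (hz k hkS) h3
    · rw [h3] at h1; simp at h1
  obtain ⟨j, hj⟩ := exists_face_eq hKa (hT.affineIndependent N hN) ((Set.image_mono hS').trans hSN)
  refine ⟨i, j, hj, fun x hx => ?_⟩
  refine (mem_face_iff hKa).2 ⟨((mem_convexHull_vert_iff hKa).1 (h ▸ hl hx)).1, hz i hi x hx⟩

/-- The vertices of a shared face are shared. -/
lemma vert_image_eq_of_face_eq (hT : IsMesh Ω T) {K N : TSimplex d} (hK : K ∈ T) (hN : N ∈ T)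
    {i j : Fin (d + 1)} (h : K.face i = N.face j) : K.vert '' {i}ᶜ = N.vert '' {j}ᶜ := by
  -- The vertices of a simplex are the extreme points of it.
  have key : ∀ {K N : TSimplex d}, AffineIndependent ℝ K.vert → AffineIndependent ℝ N.vert →
      ∀ {i j : Fin (d + 1)}, K.face i = N.face j → K.vert '' {i}ᶜ ⊆ N.vert '' {j}ᶜ := by
    rintro K N hK hN i j h _ ⟨k, hk, rfl⟩
    have hki : k ≠ i := hk
    refine Set.mem_of_mem_of_subset ?_ (extremePoints_convexHull_subset (𝕜 := ℝ))
    change K.vert k ∈ Set.extremePoints ℝ (N.face j)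
    rw [← h, mem_extremePoints]
    refine ⟨K.vert_mem_face hki, fun x hx y hy hxy => ?_⟩
    obtain ⟨a, b, ha, hb, hab, he⟩ := hxy
    have hx' := (mem_face_iff hK).1 hx
    have hy' := (mem_face_iff hK).1 hy
    have hcomb : ∀ m, a * (K.bary hK).coord m x + b * (K.bary hK).coord m y =
        if m = k then 1 else 0 := by
      intro m
      rw [← coord_vert hK m k, ← he, Convex.combo_affine_apply hab]
      simp
    have hzero : ∀ m ≠ k, (K.bary hK).coord m x = 0 ∧ (K.bary hK).coord m y = 0 := by
      intro m hm
      have h0 := hcomb m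
      rw [if_neg hm] at h0
      have h1 := mul_nonneg ha.le (hx'.1 m)
      have h2 := mul_nonneg hb.le (hy'.1 m)
      constructor
      · exact (mul_eq_zero.1 (by linarith : a * (K.bary hK).coord m x = 0)).resolve_left ha.ne'
      · exact (mul_eq_zero.1 (by linarith : b * (K.bary hK).coord m y = 0)).resolve_left hb.ne'
    have hvert : ∀ z, (∀ m ≠ k, (K.bary hK).coord m z = 0) → z = K.vert k := by
      intro z hz
      have h1 := (K.bary hK).sum_coord_apply_eq_one z
      rw [Finset.sum_eq_single k (fun m _ hm => hz m hm) (by simp)] at h1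
      refine (K.bary hK).ext_elem fun m => ?_
      rw [coord_vert]
      split_ifs with hm
      · rw [hm, h1]
      · exact hz m hm
    exact ⟨hvert x fun m hm => (hzero m hm).1, hvert y fun m hm => (hzero m hm).2⟩
  exact (key (hT.affineIndependent K hK) (hT.affineIndependent N hN) h).antisymm
    (key (hT.affineIndependent N hN) (hT.affineIndependent K hK) h.symm)

/-- Different elements that share a face lie on different sides of it. -/
lemma normal_eq_neg (hd : 0 < d) (hT : IsMesh Ω T) {K N : TSimplex d} (hK : K ∈ T) (hN : N ∈ T)
    (hne : K ≠ N) {i j : Fin (d + 1)} (h : K.face i = N.face j) : N.normal j = -K.normal i := by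
  have hKa := hT.affineIndependent K hK
  have hNa := hT.affineIndependent N hN
  have hE : ∀ x ∈ K.face i, (N.bary hNa).coord j x = 0 := fun x hx =>
    ((mem_face_iff hNa).1 (h ▸ hx)).2
  have hE' : ∀ x ∈ N.face j, (K.bary hKa).coord i x = 0 := fun x hx =>
    ((mem_face_iff hKa).1 (h ▸ hx)).2
  refine normal_eq_neg_of_neg hd hKa hNa ?_ (affineMap_eq_mul_coord_of_face hKa _ hE)
  rcases lt_or_gt_of_ne (coord_vert_ne_zero hKa hNa hE) with h0 | h0
  · exact h0
  exfalso
  -- If both were on the same side, then a point near the centroid of the face would be in the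
  -- interior of `K` and in `N`.
  have h1 := affineMap_eq_mul_coord_of_face hKa _ hE (N.vert j)
  rw [coord_vert, if_pos rfl] at h1
  have h2 : 0 < (K.bary hKa).coord i (N.vert j) := by
    by_contra hn
    have := mul_nonpos_of_nonneg_of_nonpos h0.le (not_lt.1 hn)
    linarith
  set c := K.faceCenter i with hc
  have hcN : c ∈ N.carrier := N.face_subset_carrier j (h ▸ faceCenter_mem_face hd hKa i)
  have hcont : ∀ k, Continuous fun s : ℝ => (K.bary hKa).coord k (AffineMap.lineMap c (N.vert j) s) :=
    fun k => ((K.bary hKa).coord k).continuous_of_finiteDimensional.comp AffineMap.lineMap_continuous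
  have hev : ∀ᶠ s in 𝓝[>] (0 : ℝ), ∀ k, 0 < (K.bary hKa).coord k (AffineMap.lineMap c (N.vert j) s) := by
    rw [eventually_all]
    intro k
    by_cases hk : k = i
    · filter_upwards [self_mem_nhdsWithin] with s hs
      have hs : 0 < s := hs
      rw [hk, AffineMap.apply_lineMap, hc, coord_faceCenter hd, if_pos rfl,
        AffineMap.lineMap_apply_module]
      simp only [smul_eq_mul, mul_zero, zero_add]
      positivity
    · refine nhdsWithin_le_nhds ((hcont k).continuousAt.eventually (lt_mem_nhds ?_))
      beta_reduce
      rw [AffineMap.lineMap_apply_zero, hc, coord_faceCenter hd, if_neg hk]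
      positivity
  obtain ⟨s, hs, hs01⟩ := (hev.and (Ioo_mem_nhdsGT (zero_lt_one (α := ℝ)))).exists
  have hsN : AffineMap.lineMap c (N.vert j) s ∈ N.carrier :=
    N.convex_carrier.lineMap_mem hcN (N.vert_mem_carrier j) ⟨hs01.1.le, hs01.2.le⟩
  have hsK := (mem_interior_carrier_iff hKa).2 hs
  obtain ⟨k, hk⟩ := hT.exists_inter_subset_face hK hN hne
  exact (hs k).ne' ((mem_face_iff hKa).1 (hk ⟨interior_subset hsK, hsN⟩)).2

/-- An interior face has exactly one element on its other side. -/
lemma exists_neighbors_eq (hd : 0 < d) (hT : IsMesh Ω T) {K : TSimplex d} (hK : K ∈ T)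
    {i : Fin (d + 1)} (h : T.IsInterior K i) :
    ∃ N ∈ T, N ≠ K ∧ (∃ j, N.face j = K.face i) ∧ T.neighbors K i = {N} := by
  classical
  obtain ⟨N, hN, hne, j, hj⟩ := h
  refine ⟨N, hN, hne, ⟨j, hj⟩, ?_⟩
  ext N'
  simp only [neighbors, Finset.mem_filter, Finset.mem_singleton]
  constructor
  · rintro ⟨hN', hne', j', hj'⟩
    by_contra hNN
    have h1 := hT.normal_eq_neg hd hK hN hne.symm hj.symm
    have h2 := hT.normal_eq_neg hd hK hN' hne'.symm hj'.symm
    have h3 := hT.normal_eq_neg hd hN hN' (Ne.symm hNN) (hj.trans hj'.symm)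
    rw [h1, h2, neg_neg] at h3
    have h4 : (2 : ℝ) • K.normal i = 0 := by
      rw [two_smul]; nth_rewrite 1 [← h3]; simp
    replace h4 := (smul_eq_zero.1 h4).resolve_left two_ne_zero
    have := norm_normal hd (hT.affineIndependent K hK) i
    rw [h4, norm_zero] at this
    exact zero_ne_one this
  · rintro rfl
    exact ⟨hN, hne, j, hj⟩

lemma mem_neighbors_iff {T : Mesh d} {K N : TSimplex d} {i : Fin (d + 1)} :
    N ∈ T.neighbors K i ↔ N ∈ T ∧ N ≠ K ∧ ∃ j, N.face j = K.face i := by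
  classical
  simp [neighbors]

/-- The centroid of a face that is not shared lies in no other element. -/
lemma eq_of_faceCenter_mem (hd : 0 < d) (hT : IsMesh Ω T) {K N : TSimplex d} (hK : K ∈ T)
    (hN : N ∈ T) {i : Fin (d + 1)} (hi : ¬ T.IsInterior K i) (hc : K.faceCenter i ∈ N.carrier) :
    N = K := by
  by_contra hne
  have hKa := hT.affineIndependent K hK
  obtain ⟨S, -, h, hSN⟩ := hT.exists_inter_eq hK hN (Ne.symm hne)
  have hcS : K.faceCenter i ∈ convexHull ℝ (K.vert '' S) :=
    h ▸ ⟨K.face_subset_carrier i (faceCenter_mem_face hd hKa i), hc⟩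
  have hS' : {i}ᶜ ⊆ S := by
    intro k hk
    by_contra hkS
    have hki : k ≠ i := hk
    have := ((mem_convexHull_vert_iff hKa).1 hcS).2 k hkS
    rw [coord_faceCenter hd, if_neg hki] at this
    exact (by positivity : (d : ℝ)⁻¹ ≠ 0) this
  obtain ⟨j, hj⟩ := exists_face_eq hKa (hT.affineIndependent N hN) ((Set.image_mono hS').trans hSN)
  exact hi ⟨N, hN, hne, j, by rw [face, face, hj]⟩

/-- Near the centroid of a face that is not shared, the domain is covered by one element. -/
lemma eventually_mem_carrier (hd : 0 < d) (hT : IsMesh Ω T) {K : TSimplex d} (hK : K ∈ T)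
    {i : Fin (d + 1)} (hi : ¬ T.IsInterior K i) :
    ∀ᶠ y in 𝓝 (K.faceCenter i), y ∈ closure Ω → y ∈ K.carrier := by
  have h : ∀ᶠ y in 𝓝 (K.faceCenter i), ∀ N ∈ T, N ≠ K → y ∉ N.carrier := by
    rw [Finset.eventually_all]
    intro N hN
    by_cases hne : N = K
    · simp [hne]
    · have : K.faceCenter i ∉ N.carrier := fun hc => hne (hT.eq_of_faceCenter_mem hd hK hN hi hc)
      filter_upwards [N.isCompact_carrier.isClosed.isOpen_compl.mem_nhds this] with y hy _ using hy
  filter_upwards [h] with y hy hyΩ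
  rw [hT.cover] at hyΩ
  simp only [Set.mem_iUnion] at hyΩ
  obtain ⟨N, hN, hyN⟩ := hyΩ
  by_cases hne : N = K
  · exact hne ▸ hyN
  · exact absurd hyN (hy N hN hne)

lemma carrier_subset_closure (hT : IsMesh Ω T) {K : TSimplex d} (hK : K ∈ T) :
    K.carrier ⊆ closure Ω := by
  rw [hT.cover]
  exact Set.subset_biUnion_of_mem (u := fun K : TSimplex d => K.carrier) hK

/-- A boundary face of a finer mesh lies in a boundary face of the coarser mesh. -/
lemma exists_boundary_face (hd : 0 < d) (hT : IsMesh Ω T) {T' : Mesh d} (hT' : IsMesh Ω T')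
    {K K' : TSimplex d} (hK : K ∈ T) (hK' : K' ∈ T') (hsub : K'.carrier ⊆ K.carrier)
    {i' : Fin (d + 1)} (hi' : ¬ T'.IsInterior K' i') :
    ∃ i, K'.face i' ⊆ K.face i ∧ ¬ T.IsInterior K i := by
  have hKa := hT.affineIndependent K hK
  have hKa' := hT'.affineIndependent K' hK'
  have hev := hT'.eventually_mem_carrier hd hK' hi'
  set c := K'.faceCenter i' with hc
  have hcK' : c ∈ K'.carrier := K'.face_subset_carrier i' (faceCenter_mem_face hd hKa' i')
  have hint : c ∉ interior K.carrier := by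
    intro hci
    refine faceCenter_notMem_interior hd hKa' i' ?_
    rw [mem_interior_iff_mem_nhds] at hci ⊢
    filter_upwards [hev, hci] with y hy hyK using hy (hT.carrier_subset_closure hK hyK)
  rw [mem_interior_carrier_iff hKa] at hint
  push Not at hint
  obtain ⟨i, hi⟩ := hint
  have hci : (K.bary hKa).coord i c = 0 :=
    le_antisymm hi ((mem_carrier_iff hKa).1 (hsub hcK') i)
  have hz := eq_zero_on_face_of_faceCenter hd (K := K') (i := i') ((K.bary hKa).coord i)
    (fun j _ => (mem_carrier_iff hKa).1 (hsub (K'.vert_mem_carrier j)) i) hci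
  have hface : K'.face i' ⊆ K.face i := fun x hx => (mem_face_iff hKa).2
    ⟨(mem_carrier_iff hKa).1 (hsub (K'.face_subset_carrier i' hx)), hz x hx⟩
  refine ⟨i, hface, ?_⟩
  rintro ⟨N, hN, hne, j, hj⟩
  refine hne (hT.eq_of_interior_nonempty hN hK ?_)
  have hcN : c ∈ closure (interior N.carrier) := by
    rw [N.convex_carrier.closure_interior_eq_closure_of_nonempty_interior
      (N.interior_carrier_nonempty (hT.affineIndependent N hN))]
    exact subset_closure (N.face_subset_carrier j (hj ▸ hface (faceCenter_mem_face hd hKa' i')))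
  rw [← eventually_eventually_nhds] at hev
  obtain ⟨y, hyN, hy⟩ := ((mem_closure_iff_frequently.1 hcN).and_eventually hev).exists
  refine ⟨y, ?_⟩
  rw [mem_interior_iff_mem_nhds] at hyN ⊢
  filter_upwards [hyN, hy] with z hzN hz
  exact ⟨hzN, hsub (hz (hT.carrier_subset_closure hN hzN))⟩

end Mesh.IsMesh

/-- Resolution of the parts of the boundary passes to finer meshes. -/
lemma Problem.Resolves.of_finer {d : ℕ} (hd : 0 < d) {P : Problem d} {T T' : Mesh d}
    (hres : P.Resolves T) (hT : Mesh.IsMesh P.Ω T) (hT' : Mesh.IsMesh P.Ω T')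
    (hfin : ∀ K' ∈ T', ∃ K ∈ T, K'.carrier ⊆ K.carrier) : P.Resolves T' := by
  intro K' hK' i' hi'
  obtain ⟨K, hK, hsub⟩ := hfin K' hK'
  obtain ⟨i, hface, hi⟩ := hT.exists_boundary_face hd hT' hK hK' hsub hi'
  rcases hres K hK i hi with h | h
  · exact Or.inl (hface.trans h)
  · exact Or.inr ((TSimplex.intrinsicInterior_face_mono (hT'.affineIndependent K' hK')
      (hT.affineIndependent K hK) hface).trans h)

/-! ### Bisection of a simplex -/

namespace TSimplex

variable {d : ℕ}

/-- The affine map that moves the `i`-th vertex of `K` to the midpoint between it and the `j`-th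
vertex, and fixes the other vertices. -/
noncomputable def halvingMap (K : TSimplex d) (h : AffineIndependent ℝ K.vert)
    (i j : Fin (d + 1)) : Pt d →ᵃ[ℝ] Pt d where
  toFun p := p + (K.bary h).coord i p • ((1 / 2 : ℝ) • (K.vert j - K.vert i))
  linear := LinearMap.transvection ((K.bary h).coord i).linear
    ((1 / 2 : ℝ) • (K.vert j - K.vert i))
  map_vadd' p v := by
    simp only [vadd_eq_add, LinearMap.transvection.apply]
    have := AffineMap.map_vadd ((K.bary h).coord i) p v
    simp only [vadd_eq_add] at this
    rw [this, add_smul]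
    abel

lemma halvingMap_vert (K : TSimplex d) (h : AffineIndependent ℝ K.vert) (i j : Fin (d + 1)) :
    K.halvingMap h i j ∘ K.vert = Function.update K.vert i (midpoint ℝ (K.vert i) (K.vert j)) := by
  ext1 k
  change K.vert k + (K.bary h).coord i (K.vert k) • ((1 / 2 : ℝ) • (K.vert j - K.vert i)) = _
  rw [coord_vert]
  by_cases hk : k = i
  · subst hk
    rw [if_pos rfl, one_smul, Function.update_self, midpoint_eq_smul_add, invOf_eq_inv]
    module
  · rw [if_neg (Ne.symm hk), zero_smul, add_zero, Function.update_of_ne hk]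

lemma det_halvingMap (K : TSimplex d) (h : AffineIndependent ℝ K.vert) {i j : Fin (d + 1)}
    (hij : i ≠ j) : LinearMap.det (K.halvingMap h i j).linear = 1 / 2 := by
  change LinearMap.det (LinearMap.transvection ((K.bary h).coord i).linear
    ((1 / 2 : ℝ) • (K.vert j - K.vert i))) = 1 / 2
  rw [LinearMap.transvection.det, map_smul, coord_linear_sub, coord_vert, coord_vert, if_neg hij,
    if_pos rfl]
  norm_num

lemma affineIndependent_update (K : TSimplex d) (h : AffineIndependent ℝ K.vert)
    {i j : Fin (d + 1)} (hij : i ≠ j) :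
    AffineIndependent ℝ (Function.update K.vert i (midpoint ℝ (K.vert i) (K.vert j))) := by
  rw [← halvingMap_vert K h]
  refine h.map' _ ?_
  rw [← AffineMap.linear_injective_iff]
  have hdet : LinearMap.det (K.halvingMap h i j).linear ≠ 0 := by
    rw [det_halvingMap K h hij]; norm_num
  exact (LinearMap.equivOfDetNeZero _ hdet).injective

lemma volume_image_affineMap (A : Pt d →ᵃ[ℝ] Pt d) (s : Set (Pt d)) :
    volume.real (A '' s) = |LinearMap.det A.linear| * volume.real s := by
  have : A '' s = (fun x => x + A 0) '' (A.linear '' s) := by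
    rw [Set.image_image]
    refine Set.image_congr fun x _ => ?_
    rw [AffineMap.decomp A]; simp
  rw [Measure.real, this, Set.image_add_right, measure_preimage_add_right,
    Measure.addHaar_image_linearMap, ENNReal.toReal_mul, ENNReal.toReal_ofReal (abs_nonneg _)]
  rfl

lemma volume_convexHull_update (K : TSimplex d) (h : AffineIndependent ℝ K.vert)
    {i j : Fin (d + 1)} (hij : i ≠ j) :
    volume.real (convexHull ℝ (Set.range
      (Function.update K.vert i (midpoint ℝ (K.vert i) (K.vert j))))) =
      1 / 2 * volume.real K.carrier := by
  rw [← halvingMap_vert K h, Set.range_comp, ← AffineMap.image_convexHull, volume_image_affineMap,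
    det_halvingMap K h hij]
  norm_num [carrier]

lemma convexHull_update_subset (K : TSimplex d) (i j : Fin (d + 1)) :
    convexHull ℝ (Set.range (Function.update K.vert i (midpoint ℝ (K.vert i) (K.vert j)))) ⊆
      K.carrier := by
  refine convexHull_min ?_ K.convex_carrier
  rintro _ ⟨k, rfl⟩
  by_cases hk : k = i
  · subst hk
    rw [Function.update_self]
    exact K.convex_carrier.midpoint_mem (K.vert_mem_carrier _) (K.vert_mem_carrier _)
  · rw [Function.update_of_ne hk]
    exact K.vert_mem_carrier k

/-- The positions of the vertices of the first child among those of its parent; the last vertex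
is replaced by the newest vertex. -/
def childIndex₁ (d : ℕ) (i : Fin (d + 1)) : Fin (d + 1) :=
  if i.val = 0 then 0 else if i.val = 1 then Fin.last d else Fin.ofNat (d + 1) (i.val - 1)

/-- The positions of the vertices of the second child among those of its parent of type `γ`; the
vertex `0` is replaced by the newest vertex. -/
def childIndex₂ (d γ : ℕ) (i : Fin (d + 1)) : Fin (d + 1) :=
  if i.val = 0 then Fin.last d else if i.val = 1 then 0
    else if i.val - 1 ≤ γ then Fin.ofNat (d + 1) (i.val - 1)
    else Fin.ofNat (d + 1) (d + γ - (i.val - 1))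

lemma val_childIndex₁ (i : Fin (d + 1)) : (childIndex₁ d i).val =
    if i.val = 0 then 0 else if i.val = 1 then d else i.val - 1 := by
  have := i.2
  unfold childIndex₁
  split_ifs
  · rfl
  · rfl
  · rw [Fin.val_ofNat, Nat.mod_eq_of_lt (by omega)]

lemma val_childIndex₂ {γ : ℕ} (hγ : γ < d) (i : Fin (d + 1)) : (childIndex₂ d γ i).val =
    if i.val = 0 then d else if i.val = 1 then 0 else if i.val - 1 ≤ γ then i.val - 1
      else d + γ - (i.val - 1) := by
  have := i.2
  unfold childIndex₂
  split_ifs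
  · rfl
  · rfl
  · rw [Fin.val_ofNat, Nat.mod_eq_of_lt (by omega)]
  · rw [Fin.val_ofNat, Nat.mod_eq_of_lt (by omega)]

lemma childIndex₁_injective (hd : 0 < d) : Function.Injective (childIndex₁ d) := by
  intro i j hij
  have h := congrArg Fin.val hij
  rw [val_childIndex₁, val_childIndex₁] at h
  have := i.2
  have := j.2
  ext
  split_ifs at h <;> omega

lemma childIndex₂_injective {γ : ℕ} (hγ : γ < d) : Function.Injective (childIndex₂ d γ) := by
  intro i j hij
  have h := congrArg Fin.val hij
  rw [val_childIndex₂ hγ, val_childIndex₂ hγ] at h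
  have := i.2
  have := j.2
  ext
  split_ifs at h <;> omega

lemma child₁_vert (hd : 0 < d) (K : TSimplex d) : K.child₁.vert =
    Function.update K.vert (Fin.last d) (midpoint ℝ (K.vert (Fin.last d)) (K.vert 0)) ∘
      childIndex₁ d := by
  ext1 i
  have hv := val_childIndex₁ i
  have := i.2
  simp only [child₁, Function.comp]
  split_ifs with h0 h1
  · rw [Function.update_of_ne]
    · congr 1; ext; rw [hv, if_pos h0]; rfl
    · rw [ne_eq, Fin.ext_iff, hv, if_pos h0, Fin.val_last]; omega
  · have : childIndex₁ d i = Fin.last d := by ext; rw [hv, if_neg h0, if_pos h1]; rfl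
    rw [this, Function.update_self, newVert, midpoint_comm]
  · rw [Function.update_of_ne]
    · congr 1; unfold childIndex₁; rw [if_neg h0, if_neg h1]
    · rw [ne_eq, Fin.ext_iff, hv, if_neg h0, if_neg h1, Fin.val_last]; omega

lemma child₂_vert (K : TSimplex d) (hγ : K.tag < d) : K.child₂.vert =
    Function.update K.vert 0 (midpoint ℝ (K.vert 0) (K.vert (Fin.last d))) ∘
      childIndex₂ d K.tag := by
  ext1 i
  have hv := val_childIndex₂ hγ i
  have := i.2
  simp only [child₂, Function.comp]
  by_cases h0 : i.val = 0
  · rw [if_pos h0, Function.update_of_ne]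
    · congr 1; unfold childIndex₂; rw [if_pos h0]
    · rw [ne_eq, Fin.ext_iff, hv, if_pos h0, Fin.val_zero]; omega
  by_cases h1 : i.val = 1
  · have : childIndex₂ d K.tag i = 0 := by ext; rw [hv, if_neg h0, if_pos h1]; rfl
    rw [if_neg h0, if_pos h1, this, Function.update_self, newVert]
  rw [if_neg h0, if_neg h1, Function.update_of_ne]
  · unfold childIndex₂; rw [if_neg h0, if_neg h1]; split_ifs <;> rfl
  · rw [ne_eq, Fin.ext_iff, hv, if_neg h0, if_neg h1, Fin.val_zero]; split_ifs <;> omega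

lemma child₁_props (hd : 0 < d) (K : TSimplex d) (h : AffineIndependent ℝ K.vert) :
    AffineIndependent ℝ K.child₁.vert ∧ K.child₁.carrier ⊆ K.carrier ∧
      volume.real K.child₁.carrier = 1 / 2 * volume.real K.carrier := by
  have hne : Fin.last d ≠ 0 := by rw [ne_eq, Fin.ext_iff, Fin.val_last, Fin.val_zero]; omega
  have hr : Set.range K.child₁.vert = Set.range (Function.update K.vert (Fin.last d)
      (midpoint ℝ (K.vert (Fin.last d)) (K.vert 0))) := by
    rw [child₁_vert hd, Function.Surjective.range_comp
      (Finite.surjective_of_injective (childIndex₁_injective hd))]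
  refine ⟨?_, ?_, ?_⟩
  · rw [child₁_vert hd]
    exact (K.affineIndependent_update h hne).comp_embedding ⟨_, childIndex₁_injective hd⟩
  · rw [carrier, hr]; exact K.convexHull_update_subset _ _
  · rw [carrier, hr]; exact K.volume_convexHull_update h hne

lemma child₂_props (K : TSimplex d) (hγ : K.tag < d) (h : AffineIndependent ℝ K.vert) :
    AffineIndependent ℝ K.child₂.vert ∧ K.child₂.carrier ⊆ K.carrier ∧
      volume.real K.child₂.carrier = 1 / 2 * volume.real K.carrier := by
  have hne : (0 : Fin (d + 1)) ≠ Fin.last d := by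
    rw [ne_eq, Fin.ext_iff, Fin.val_last, Fin.val_zero]; omega
  have hr : Set.range K.child₂.vert = Set.range (Function.update K.vert 0
      (midpoint ℝ (K.vert 0) (K.vert (Fin.last d)))) := by
    rw [child₂_vert K hγ, Function.Surjective.range_comp
      (Finite.surjective_of_injective (childIndex₂_injective hγ))]
  refine ⟨?_, ?_, ?_⟩
  · rw [child₂_vert K hγ]
    exact (K.affineIndependent_update h hne).comp_embedding ⟨_, childIndex₂_injective hγ⟩
  · rw [carrier, hr]; exact K.convexHull_update_subset _ _
  · rw [carrier, hr]; exact K.volume_convexHull_update h hne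

/-- `L` arises from `K` by `n` bisections. -/
inductive IsDescendant (K : TSimplex d) : ℕ → TSimplex d → Prop
  | refl : IsDescendant K 0 K
  | child₁ {n : ℕ} {L : TSimplex d} : IsDescendant K n L → IsDescendant K (n + 1) L.child₁
  | child₂ {n : ℕ} {L : TSimplex d} : IsDescendant K n L → IsDescendant K (n + 1) L.child₂

lemma IsDescendant.trans {K L N : TSimplex d} {n m : ℕ} (h : IsDescendant K n L)
    (h' : IsDescendant L m N) : IsDescendant K (n + m) N := by
  induction h' with
  | refl => exact h
  | child₁ _ ih => exact ih.child₁
  | child₂ _ ih => exact ih.child₂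

lemma IsDescendant.props {K L : TSimplex d} {n : ℕ} (h : IsDescendant K n L)
    (hK : AffineIndependent ℝ K.vert) (hγ : K.tag < d) :
    AffineIndependent ℝ L.vert ∧ L.tag < d ∧ L.carrier ⊆ K.carrier ∧
      volume.real L.carrier = (1 / 2) ^ n * volume.real K.carrier := by
  induction h with
  | refl => exact ⟨hK, hγ, subset_rfl, by simp⟩
  | child₁ _ ih =>
    obtain ⟨h1, h2, h3, h4⟩ := ih
    have hd : 0 < d := by omega
    obtain ⟨c1, c2, c3⟩ := child₁_props hd _ h1
    exact ⟨c1, Nat.mod_lt _ hd, c2.trans h3, by rw [c3, h4, pow_succ]; ring⟩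
  | child₂ _ ih =>
    obtain ⟨h1, h2, h3, h4⟩ := ih
    have hd : 0 < d := by omega
    obtain ⟨c1, c2, c3⟩ := child₂_props _ h2 h1
    exact ⟨c1, Nat.mod_lt _ hd, c2.trans h3, by rw [c3, h4, pow_succ]; ring⟩

end TSimplex

/-! ### Refinements of a mesh -/

namespace Mesh

open TSimplex

variable {d : ℕ}

lemma mem_bisect {T M : Mesh d} {L : TSimplex d} (hM : M ⊆ T) (hL : L ∈ bisect T M) :
    ∃ K ∈ T, ∃ n, IsDescendant K n L := by
  simp only [bisect, Finset.mem_union, Finset.mem_sdiff, Finset.mem_biUnion, Finset.mem_insert,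
    Finset.mem_singleton] at hL
  rcases hL with ⟨h, -⟩ | ⟨K, hK, rfl | rfl⟩
  · exact ⟨L, h, 0, .refl⟩
  · exact ⟨K, hM hK, 1, .child₁ .refl⟩
  · exact ⟨K, hM hK, 1, .child₂ .refl⟩

lemma mem_closureStep_iterate {T : Mesh d} (n : ℕ) {L : TSimplex d}
    (hL : L ∈ closureStep^[n] T) : ∃ K ∈ T, ∃ m, IsDescendant K m L := by
  induction n generalizing L with
  | zero => exact ⟨L, hL, 0, .refl⟩
  | succ n ih =>
    rw [Function.iterate_succ_apply'] at hL
    classical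
    obtain ⟨K, hK, m, h⟩ := mem_bisect (by rw [hanging]; exact Finset.filter_subset _ _) hL
    obtain ⟨K', hK', m', h'⟩ := ih hK
    exact ⟨K', hK', _, h'.trans h⟩

lemma exists_ancestor {Ω : Set (Pt d)} {T T' : Mesh d} (hT' : T' ∈ refinements Ω T)
    {L : TSimplex d} (hL : L ∈ T') : ∃ K ∈ T, ∃ n, IsDescendant K n L := by
  have h : Relation.ReflTransGen (fun S S' => ∃ M, IsNVB Ω S M S') T T' := hT'
  induction h generalizing L with
  | refl => exact ⟨L, hL, 0, .refl⟩
  | tail h1 h2 ih =>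
    obtain ⟨M, hM, ⟨n, rfl⟩, -, -⟩ := h2
    obtain ⟨K, hK, m, h⟩ := mem_closureStep_iterate n hL
    obtain ⟨K', hK', m', h'⟩ := mem_bisect hM hK
    obtain ⟨K'', hK'', m'', h''⟩ := ih h1 hK'
    exact ⟨K'', hK'', _, h''.trans (h'.trans h)⟩

lemma IsMesh.of_mem_refinements {Ω : Set (Pt d)} {T T' : Mesh d} (hT : IsMesh Ω T)
    (hT' : T' ∈ refinements Ω T) : IsMesh Ω T' := by
  have h : Relation.ReflTransGen (fun S S' => ∃ M, IsNVB Ω S M S') T T' := hT'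
  rcases h.cases_tail with h | ⟨S, -, M, -, -, -, h⟩
  · exact h ▸ hT
  · exact h

/-- A new element of a refined mesh is a proper descendant of an element that is refined. -/
lemma exists_refined_ancestor {Ω : Set (Pt d)} {T T' : Mesh d} (hT : IsMesh Ω T)
    (hT' : T' ∈ refinements Ω T) {L : TSimplex d} (hL : L ∈ T' \ T) :
    ∃ K ∈ T \ T', L.carrier ⊆ K.carrier ∧
      volume.real L.carrier ≤ 1 / 2 * volume.real K.carrier := by
  rw [Finset.mem_sdiff] at hL
  obtain ⟨K, hK, n, h⟩ := exists_ancestor hT' hL.1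
  obtain ⟨-, -, hsub, hvol⟩ := h.props (hT.affineIndependent K hK) (hT.tag_lt K hK)
  have hn : n ≠ 0 := by
    rintro rfl
    cases h
    exact hL.2 hK
  refine ⟨K, Finset.mem_sdiff.2 ⟨hK, fun hK' => hL.2 ?_⟩, hsub, ?_⟩
  · exact (hT.of_mem_refinements hT').eq_of_subset hL.1 hK' hsub ▸ hK
  · rw [hvol]
    refine mul_le_mul_of_nonneg_right ?_ measureReal_nonneg
    calc (1 / 2 : ℝ) ^ n ≤ (1 / 2) ^ 1 :=
          pow_le_pow_of_le_one (by norm_num) (by norm_num) (Nat.one_le_iff_ne_zero.2 hn)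
      _ = 1 / 2 := pow_one _

end Mesh

/-! ### Shape regularity -/

namespace TSimplex

variable {d : ℕ}

/-- The `n`-th vertex of the simplex of type `γ` with first vertex `p` that arises by `γ`
bisections, always keeping the first child, from the Kuhn simplex with vertices
`p, p + a 0, p + a 0 + a 1, …`. -/
noncomputable def kuhnVert (d γ : ℕ) (p : Pt d) (a : ℕ → Pt d) (n : ℕ) : Pt d :=
  if n = 0 then p
  else if n ≤ γ then p + (1 / 2 : ℝ) • ∑ j ∈ Finset.range (d - γ + n), a j
  else p + ∑ j ∈ Finset.range (n - γ), a j

/-- The edge vectors of the second child of a Kuhn simplex: the first `m` ones are reversed. -/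
def reverseEdges (m : ℕ) (a : ℕ → Pt d) (j : ℕ) : Pt d :=
  if j < m then -a (m - 1 - j) else a j

lemma sum_reverseEdges_of_le {m : ℕ} (a : ℕ → Pt d) {n : ℕ} (hn : n ≤ m) :
    ∑ j ∈ Finset.range n, reverseEdges m a j =
      ∑ j ∈ Finset.range (m - n), a j - ∑ j ∈ Finset.range m, a j := by
  induction n with
  | zero => simp
  | succ n ih =>
    rw [Finset.sum_range_succ, ih (by omega), reverseEdges, if_pos (by omega),
      show m - n = m - (n + 1) + 1 by omega, Finset.sum_range_succ,
      show m - 1 - n = m - (n + 1) by omega]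
    abel

lemma sum_reverseEdges_of_ge {m : ℕ} (a : ℕ → Pt d) {n : ℕ} (hn : m ≤ n) :
    ∑ j ∈ Finset.range n, reverseEdges m a j =
      ∑ j ∈ Finset.range n, a j - (2 : ℝ) • ∑ j ∈ Finset.range m, a j := by
  induction n, hn using Nat.le_induction with
  | base => rw [sum_reverseEdges_of_le a le_rfl, Nat.sub_self, Finset.sum_range_zero]; module
  | succ n hn ih =>
    rw [Finset.sum_range_succ, ih, Finset.sum_range_succ, reverseEdges, if_neg (by omega)]
    abel

lemma kuhnVert_last {γ : ℕ} (hγ : γ < d) (p : Pt d) (a : ℕ → Pt d) :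
    kuhnVert d γ p a d = p + ∑ j ∈ Finset.range (d - γ), a j := by
  rw [kuhnVert, if_neg (by omega), if_neg (by omega)]

lemma newVert_eq {K : TSimplex d} (hγ : K.tag < d) {p : Pt d} {a : ℕ → Pt d}
    (h : ∀ i : Fin (d + 1), K.vert i = kuhnVert d K.tag p a i) :
    K.newVert = p + (1 / 2 : ℝ) • ∑ j ∈ Finset.range (d - K.tag), a j := by
  rw [newVert, h, h, Fin.val_last, kuhnVert_last hγ, Fin.val_zero, kuhnVert, if_pos rfl,
    midpoint_eq_smul_add, invOf_eq_inv]
  module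

lemma child₁_kuhnVert {K : TSimplex d} (hγ : K.tag < d) {p : Pt d} {a : ℕ → Pt d}
    (h : ∀ i : Fin (d + 1), K.vert i = kuhnVert d K.tag p a i) (i : Fin (d + 1)) :
    K.child₁.vert i = kuhnVert d (K.tag + 1) p a i := by
  have hi := i.2
  simp only [child₁]
  by_cases h0 : i.val = 0
  · rw [if_pos h0, h, Fin.val_zero, h0]; simp [kuhnVert]
  by_cases h1 : i.val = 1
  · rw [if_neg h0, if_pos h1, newVert_eq hγ h, h1, kuhnVert, if_neg one_ne_zero,
      if_pos (by omega), show d - (K.tag + 1) + 1 = d - K.tag by omega]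
  rw [if_neg h0, if_neg h1, h, Fin.val_ofNat, Nat.mod_eq_of_lt (by omega), kuhnVert, kuhnVert,
    if_neg (by omega), if_neg h0]
  by_cases h2 : i.val - 1 ≤ K.tag
  · rw [if_pos h2, if_pos (by omega),
      show d - (K.tag + 1) + i.val = d - K.tag + (i.val - 1) by omega]
  · rw [if_neg h2, if_neg (by omega), show i.val - (K.tag + 1) = i.val - 1 - K.tag by omega]

lemma child₂_kuhnVert {K : TSimplex d} (hγ : K.tag < d) {p : Pt d} {a : ℕ → Pt d}
    (h : ∀ i : Fin (d + 1), K.vert i = kuhnVert d K.tag p a i) (i : Fin (d + 1)) :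
    K.child₂.vert i = kuhnVert d (K.tag + 1) (p + ∑ j ∈ Finset.range (d - K.tag), a j)
      (reverseEdges (d - K.tag) a) i := by
  have hi := i.2
  simp only [child₂]
  by_cases h0 : i.val = 0
  · rw [if_pos h0, h, Fin.val_last, h0, kuhnVert_last hγ]; simp [kuhnVert]
  by_cases h1 : i.val = 1
  · rw [if_neg h0, if_pos h1, newVert_eq hγ h, h1, kuhnVert, if_neg one_ne_zero,
      if_pos (by omega), show d - (K.tag + 1) + 1 = d - K.tag by omega,
      sum_reverseEdges_of_le a le_rfl, Nat.sub_self, Finset.sum_range_zero]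
    module
  rw [if_neg h0, if_neg h1]
  by_cases h2 : i.val - 1 ≤ K.tag
  · rw [if_pos h2, h, Fin.val_ofNat, Nat.mod_eq_of_lt (by omega), kuhnVert, kuhnVert,
      if_neg (by omega), if_neg h0, if_pos h2, if_pos (by omega),
      sum_reverseEdges_of_ge a (by omega),
      show d - (K.tag + 1) + i.val = d - K.tag + (i.val - 1) by omega]
    module
  · rw [if_neg h2, h, Fin.val_ofNat, Nat.mod_eq_of_lt (by omega), kuhnVert, kuhnVert,
      if_neg (by omega), if_neg h0, if_neg (by omega), if_neg (by omega),
      sum_reverseEdges_of_le a (by omega),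
      show d + K.tag - (i.val - 1) - K.tag = d - K.tag - (i.val - (K.tag + 1)) by omega]
    module

/-- After `d` bisections a Kuhn simplex is again a Kuhn simplex, of half the size. -/
lemma kuhnVert_self (p : Pt d) (a : ℕ → Pt d) {n : ℕ} (hn : n ≤ d) :
    kuhnVert d d p a n = kuhnVert d 0 p (fun j => (1 / 2 : ℝ) • a j) n := by
  by_cases h0 : n = 0
  · simp [kuhnVert, h0]
  · rw [kuhnVert, kuhnVert, if_neg h0, if_neg h0, if_pos hn, if_neg (by omega), ← Finset.smul_sum]
    simp

/-- The vectors `a 0, …, a (d - 1)` form a basis of size `s`, up to a factor `M`. -/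
structure IsBasisOfSize (M s : ℝ) (a : ℕ → Pt d) : Prop where
  norm_le : ∀ j < d, ‖a j‖ ≤ M * s
  le_norm : ∀ t : ℕ → ℝ, ∀ j < d, M⁻¹ * s * |t j| ≤ ‖∑ k ∈ Finset.range d, t k • a k‖

lemma IsBasisOfSize.half {M s : ℝ} {a : ℕ → Pt d} (h : IsBasisOfSize M s a) :
    IsBasisOfSize M (s / 2) fun j => (1 / 2 : ℝ) • a j where
  norm_le j hj := by
    rw [norm_smul]
    have := h.norm_le j hj
    norm_num
    linarith
  le_norm t j hj := by
    have := h.le_norm t j hj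
    have h2 : ∑ k ∈ Finset.range d, t k • ((1 / 2 : ℝ) • a k) =
        (1 / 2 : ℝ) • ∑ k ∈ Finset.range d, t k • a k := by
      rw [Finset.smul_sum]
      exact Finset.sum_congr rfl fun k _ => smul_comm _ _ _
    rw [h2, norm_smul]
    norm_num
    linarith

lemma IsBasisOfSize.reverse {M s : ℝ} {a : ℕ → Pt d} (h : IsBasisOfSize M s a) {m : ℕ}
    (hm : m ≤ d) : IsBasisOfSize M s (reverseEdges m a) where
  norm_le j hj := by
    rw [reverseEdges]
    split_ifs
    · rw [norm_neg]; exact h.norm_le _ (by omega)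
    · exact h.norm_le _ hj
  le_norm t j hj := by
    set r : ℕ → ℕ := fun j => if j < m then m - 1 - j else j with hr
    set t' : ℕ → ℝ := fun j => if j < m then -t (m - 1 - j) else t j with ht'
    have hrr : ∀ j, r (r j) = j := fun j => by
      simp only [hr]; split_ifs <;> omega
    have hrd : ∀ j ∈ Finset.range d, r j ∈ Finset.range d := fun j hj => by
      simp only [hr, Finset.mem_range] at hj ⊢; split_ifs <;> omega
    have ht : ∀ j, |t' (r j)| = |t j| := fun j => by
      simp only [hr, ht']
      split_ifs with h1 h2
      · rw [abs_neg, show m - 1 - (m - 1 - j) = j by omega]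
      · omega
      · rfl
    have hsum : ∑ k ∈ Finset.range d, t k • reverseEdges m a k =
        ∑ k ∈ Finset.range d, t' k • a k := by
      refine Finset.sum_nbij' r r hrd hrd (fun j _ => hrr j) (fun j _ => hrr j) fun j _ => ?_
      simp only [hr, ht', reverseEdges]
      split_ifs with h1 h2
      · rw [smul_neg, neg_smul, show m - 1 - (m - 1 - j) = j by omega]
      · omega
      · rfl
    rw [hsum, ← ht]
    exact h.le_norm t' (r j) (Finset.mem_range.1 (hrd j (Finset.mem_range.2 hj)))

/-- `K` is the image of a Kuhn simplex, or one of its descendants up to the next generation, with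
edge vectors of size `s`. -/
def IsKuhn (M s : ℝ) (K : TSimplex d) : Prop :=
  ∃ (p : Pt d) (a : ℕ → Pt d), (∀ i : Fin (d + 1), K.vert i = kuhnVert d K.tag p a i) ∧
    IsBasisOfSize M s a

/-- Descendants keep the shape of a Kuhn simplex; the size halves every `d` generations. -/
lemma IsDescendant.isKuhn {M : ℝ} {K L : TSimplex d} {n : ℕ} (h : IsDescendant K n L)
    (hK : AffineIndependent ℝ K.vert) (hγ : K.tag < d) (hM : IsKuhn M 1 K) :
    ∃ q : ℕ, K.tag + n = d * q + L.tag ∧ IsKuhn M ((1 / 2) ^ q) L := by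
  have step : ∀ {L C : TSimplex d} {n : ℕ} {p : Pt d} {a : ℕ → Pt d} {q : ℕ}, L.tag < d →
      K.tag + n = d * q + L.tag → C.tag = (L.tag + 1) % d →
      (∀ i : Fin (d + 1), C.vert i = kuhnVert d (L.tag + 1) p a i) →
      IsBasisOfSize M ((1 / 2) ^ q) a →
      ∃ q : ℕ, K.tag + (n + 1) = d * q + C.tag ∧ IsKuhn M ((1 / 2) ^ q) C := by
    intro L C n p a q hL hq hC hv ha
    by_cases hlt : L.tag + 1 < d
    · rw [Nat.mod_eq_of_lt hlt] at hC
      exact ⟨q, by omega, p, a, by rwa [hC], ha⟩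
    · have he : L.tag + 1 = d := by omega
      rw [he, Nat.mod_self] at hC
      refine ⟨q + 1, by rw [Nat.mul_succ]; omega, p, fun j => (1 / 2 : ℝ) • a j, fun i => ?_, ?_⟩
      · rw [hv, he, hC, kuhnVert_self p a (by omega)]
      · have := ha.half
        rwa [pow_succ, mul_one_div]
  induction h with
  | refl => exact ⟨0, by simp, by simpa using hM⟩
  | child₁ h ih =>
    obtain ⟨q, hq, p, a, hv, ha⟩ := ih
    have hL := (h.props hK hγ).2.1
    exact step hL hq rfl (child₁_kuhnVert hL hv) ha
  | child₂ h ih =>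
    obtain ⟨q, hq, p, a, hv, ha⟩ := ih
    have hL := (h.props hK hγ).2.1
    exact step hL hq rfl (child₂_kuhnVert hL hv) (ha.reverse (by omega))

/-- The coefficients of the vertices in the edge vectors. -/
noncomputable def kuhnCoeff (d γ n j : ℕ) : ℝ :=
  if n = 0 then 0
  else if n ≤ γ then (if j < d - γ + n then 1 / 2 else 0)
  else (if j < n - γ then 1 else 0)

lemma kuhnVert_eq_sum {γ n : ℕ} (hn : n ≤ d) (hγ : γ < d) (p : Pt d) (a : ℕ → Pt d) :
    kuhnVert d γ p a n = p + ∑ j ∈ Finset.range d, kuhnCoeff d γ n j • a j := by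
  have key : ∀ m ≤ d, ∀ c : ℝ, ∑ j ∈ Finset.range d, (if j < m then c else 0) • a j =
      c • ∑ j ∈ Finset.range m, a j := by
    intro m hm c
    rw [Finset.smul_sum, ← Finset.sum_subset (Finset.range_mono hm)]
    · exact Finset.sum_congr rfl fun j hj => by rw [if_pos (Finset.mem_range.1 hj)]
    · intro j _ hj
      rw [if_neg (by simpa using hj), zero_smul]
  unfold kuhnVert kuhnCoeff
  split_ifs with h0 h1
  · simp
  · rw [key _ (by omega)]
  · rw [key _ (by omega), one_smul]

lemma abs_kuhnCoeff_sub_le (γ m n j : ℕ) : |kuhnCoeff d γ m j - kuhnCoeff d γ n j| ≤ 1 := by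
  unfold kuhnCoeff
  split_ifs <;> norm_num

lemma exists_half_le_kuhnCoeff_sub {γ m n : ℕ} (hγ : γ < d) (hm : m < n) (hn : n ≤ d) :
    ∃ j < d, 1 / 2 ≤ |kuhnCoeff d γ m j - kuhnCoeff d γ n j| := by
  unfold kuhnCoeff
  have hn0 : n ≠ 0 := by omega
  by_cases h0 : m = 0
  · refine ⟨0, by omega, ?_⟩
    rw [if_pos h0, if_neg hn0]
    split_ifs <;> first | omega | norm_num
  by_cases h1 : n ≤ γ
  · refine ⟨d - γ + m, by omega, ?_⟩
    rw [if_neg h0, if_pos (by omega), if_neg (by omega), if_neg hn0, if_pos h1, if_pos (by omega)]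
    norm_num
  by_cases h2 : m ≤ γ
  · refine ⟨0, by omega, ?_⟩
    rw [if_neg h0, if_pos h2, if_pos (by omega), if_neg hn0, if_neg h1, if_pos (by omega)]
    norm_num
  · refine ⟨m - γ, by omega, ?_⟩
    rw [if_neg h0, if_neg h2, if_neg (by omega), if_neg hn0, if_neg h1, if_pos (by omega)]
    norm_num

lemma kuhnVert_sub {γ m n : ℕ} (hγ : γ < d) (hm : m ≤ d) (hn : n ≤ d) (p : Pt d)
    (a : ℕ → Pt d) : kuhnVert d γ p a m - kuhnVert d γ p a n =
      ∑ j ∈ Finset.range d, (kuhnCoeff d γ m j - kuhnCoeff d γ n j) • a j := by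
  rw [kuhnVert_eq_sum hm hγ, kuhnVert_eq_sum hn hγ]
  simp only [sub_smul, Finset.sum_sub_distrib]
  abel

lemma IsKuhn.edge_le {M s : ℝ} {K : TSimplex d} (hγ : K.tag < d) (h : IsKuhn M s K)
    (i j : Fin (d + 1)) : ‖K.vert i - K.vert j‖ ≤ d * (M * s) := by
  obtain ⟨p, a, hv, ha⟩ := h
  rw [hv, hv, kuhnVert_sub hγ (by omega) (by omega)]
  refine (norm_sum_le _ _).trans ?_
  refine (Finset.sum_le_card_nsmul _ _ (M * s) fun k hk => ?_).trans_eq (by simp)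
  rw [norm_smul, Real.norm_eq_abs]
  have h1 := abs_kuhnCoeff_sub_le (d := d) K.tag i j k
  have h2 := ha.norm_le k (Finset.mem_range.1 hk)
  calc _ ≤ 1 * ‖a k‖ := mul_le_mul_of_nonneg_right h1 (norm_nonneg _)
    _ ≤ _ := by rwa [one_mul]

lemma IsKuhn.le_edge {M s : ℝ} {K : TSimplex d} (hM : 0 ≤ M⁻¹ * s) (hγ : K.tag < d)
    (h : IsKuhn M s K) {i j : Fin (d + 1)} (hij : i ≠ j) :
    M⁻¹ * s / 2 ≤ ‖K.vert i - K.vert j‖ := by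
  wlog hlt : i < j generalizing i j
  · rw [norm_sub_rev]
    exact this hij.symm (lt_of_le_of_ne (not_lt.1 hlt) hij.symm)
  obtain ⟨p, a, hv, ha⟩ := h
  rw [hv, hv, kuhnVert_sub hγ (by omega) (by omega)]
  obtain ⟨k, hk, hk2⟩ := exists_half_le_kuhnCoeff_sub hγ hlt (by omega : j.val ≤ d)
  have := ha.le_norm (fun k => kuhnCoeff d K.tag i k - kuhnCoeff d K.tag j k) k hk
  refine le_trans ?_ this
  have := mul_le_mul_of_nonneg_left hk2 hM
  linarith

/-- Every nondegenerate simplex is the image of a Kuhn simplex or one of its descendants. -/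
lemma exists_isKuhn {K : TSimplex d} (hK : AffineIndependent ℝ K.vert) (hγ : K.tag < d) :
    ∃ M : ℝ, 0 < M ∧ IsKuhn M 1 K := by
  -- `y m` is the difference between the first vertex and the `m`-th vertex of the Kuhn simplex.
  set x : ℕ → Pt d := fun n => K.vert (Fin.ofNat (d + 1) n) - K.vert 0 with hx
  set y : ℕ → Pt d := fun m => if m = 0 then 0 else if m ≤ d - K.tag then x (K.tag + m)
    else (2 : ℝ) • x (m - (d - K.tag)) with hy
  set a : ℕ → Pt d := fun j => y (j + 1) - y j with ha
  have hsum : ∀ m, ∑ j ∈ Finset.range m, a j = y m := fun m => by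
    rw [ha, Finset.sum_range_sub]; simp [hy]
  have hv : ∀ i : Fin (d + 1), K.vert i = kuhnVert d K.tag (K.vert 0) a i := by
    intro i
    have hi := i.2
    have hxi : x i = K.vert i - K.vert 0 := by
      simp only [hx]; congr 2; ext; rw [Fin.val_ofNat, Nat.mod_eq_of_lt hi]
    rw [kuhnVert, hsum, hsum]
    split_ifs with h0 h1
    · congr 1
      ext; simpa using h0
    · simp only [hy]
      rw [if_neg (by omega), if_neg (by omega), Nat.add_sub_cancel_left, smul_smul, hxi]
      norm_num
    · simp only [hy]
      rw [if_neg (by omega), if_pos (by omega), show K.tag + (i.val - K.tag) = i.val by omega, hxi]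
      abel
  -- The edge vectors span the whole space, hence they are linearly independent.
  set Λ : (Fin d → ℝ) →ₗ[ℝ] Pt d := Fintype.linearCombination ℝ (fun j : Fin d => a j) with hΛ
  have hΛa : ∀ t, Λ t = ∑ j : Fin d, t j • a j := fun t => by
    rw [hΛ, Fintype.linearCombination_apply]
  have hmem : ∀ i, K.vert i - K.vert 0 ∈ LinearMap.range Λ := by
    intro i
    rw [hv i, kuhnVert_eq_sum (by omega) hγ, add_sub_cancel_left]
    refine ⟨fun j => kuhnCoeff d K.tag i j, ?_⟩
    rw [hΛa, Finset.sum_range]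
  have hsurj : Function.Surjective Λ := by
    rw [← LinearMap.range_eq_top, eq_top_iff]
    have htop : vectorSpan ℝ (Set.range K.vert) = ⊤ := by
      rw [← direction_affineSpan]
      have := (K.bary hK).tot
      rw [coe_bary] at this
      rw [this, AffineSubspace.direction_top]
    rw [← htop, vectorSpan_range_eq_span_range_vsub_right ℝ K.vert 0, Submodule.span_le]
    rintro _ ⟨i, rfl⟩
    exact hmem i
  have hinj : Function.Injective Λ := by
    rw [LinearMap.injective_iff_surjective_of_finrank_eq_finrank (by simp)]
    exact hsurj
  obtain ⟨κ, hκ, hanti⟩ := LinearMap.exists_antilipschitzWith Λ (LinearMap.ker_eq_bot.2 hinj)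
  set M : ℝ := κ + ∑ j ∈ Finset.range d, ‖a j‖ with hM
  have hκ' : (0 : ℝ) < κ := hκ
  have hMκ : (κ : ℝ) ≤ M := le_add_of_nonneg_right (Finset.sum_nonneg fun _ _ => norm_nonneg _)
  have hM0 : 0 < M := hκ'.trans_le hMκ
  refine ⟨M, hM0, K.vert 0, a, hv, fun j hj => ?_, fun t j hj => ?_⟩
  · rw [mul_one]
    exact (Finset.single_le_sum (f := fun j => ‖a j‖) (fun _ _ => norm_nonneg _)
      (Finset.mem_range.2 hj)).trans (le_add_of_nonneg_left hκ'.le)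
  · have h1 := hanti.le_mul_dist (fun j : Fin d => t j) 0
    rw [map_zero, dist_zero_right, dist_zero_right, hΛa, ← Finset.sum_range (fun j => t j • a j)]
      at h1
    have h2 := norm_le_pi_norm (fun j : Fin d => t j) ⟨j, hj⟩
    rw [Real.norm_eq_abs] at h2
    rw [mul_one, inv_mul_le_iff₀ hM0]
    exact (h2.trans h1).trans (mul_le_mul_of_nonneg_right hMκ (norm_nonneg _))

lemma volume_carrier_pos {K : TSimplex d} (hK : AffineIndependent ℝ K.vert) :
    0 < volume.real K.carrier := by
  refine ENNReal.toReal_pos ?_ K.isCompact_carrier.measure_lt_top.ne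
  exact ((isOpen_interior.measure_pos volume (K.interior_carrier_nonempty hK)).trans_le
    (measure_mono interior_subset)).ne'

/-- The edges of `K` and the `d`-th root of its volume are equivalent to `s`, up to a factor
`M`. -/
structure IsShapeRegular (M s : ℝ) (K : TSimplex d) : Prop where
  pos : 0 < s
  le_one : s ≤ 1
  edge_le : ∀ i j, ‖K.vert i - K.vert j‖ ≤ M * s
  le_edge : ∀ i j, i ≠ j → s ≤ M * ‖K.vert i - K.vert j‖
  volume_le : volume.real K.carrier ≤ M * s ^ d
  le_volume : s ^ d ≤ M * volume.real K.carrier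

lemma IsShapeRegular.mono {M M' s : ℝ} {K : TSimplex d} (h : IsShapeRegular M s K)
    (hM : M ≤ M') : IsShapeRegular M' s K where
  pos := h.pos
  le_one := h.le_one
  edge_le i j := (h.edge_le i j).trans (mul_le_mul_of_nonneg_right hM h.pos.le)
  le_edge i j hij := (h.le_edge i j hij).trans (mul_le_mul_of_nonneg_right hM (norm_nonneg _))
  volume_le := h.volume_le.trans (mul_le_mul_of_nonneg_right hM (pow_pos h.pos d).le)
  le_volume := h.le_volume.trans (mul_le_mul_of_nonneg_right hM measureReal_nonneg)

lemma exists_isShapeRegular {K : TSimplex d} (hK : AffineIndependent ℝ K.vert) (hγ : K.tag < d) :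
    ∃ M : ℝ, ∀ n L, IsDescendant K n L → ∃ s, IsShapeRegular M s L := by
  obtain ⟨M, hM, hKM⟩ := exists_isKuhn hK hγ
  have hv := volume_carrier_pos hK
  set v := volume.real K.carrier with hvdef
  refine ⟨d * M + 2 * M + 2 ^ d * v + 2 ^ d * v⁻¹, fun n L h => ?_⟩
  obtain ⟨q, hq, hL⟩ := h.isKuhn hK hγ hKM
  obtain ⟨-, hLγ, -, hvol⟩ := h.props hK hγ
  rw [← hvdef] at hvol
  set s : ℝ := (1 / 2) ^ q with hs
  have hs0 : 0 < s := by positivity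
  refine ⟨s, hs0, pow_le_one₀ (by norm_num) (by norm_num), fun i j => ?_, fun i j hij => ?_, ?_, ?_⟩
  · refine (hL.edge_le hLγ i j).trans ?_
    rw [← mul_assoc]
    refine mul_le_mul_of_nonneg_right ?_ hs0.le
    have : 0 < 2 * M + 2 ^ d * v + 2 ^ d * v⁻¹ := by positivity
    linarith
  · have h1 := hL.le_edge (by positivity) hLγ hij
    have h2 : s ≤ 2 * M * ‖L.vert i - L.vert j‖ := by
      have := mul_le_mul_of_nonneg_left h1 (by positivity : 0 ≤ 2 * M)
      calc s = 2 * M * (M⁻¹ * s / 2) := by field_simp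
        _ ≤ _ := this
    refine h2.trans (mul_le_mul_of_nonneg_right ?_ (norm_nonneg _))
    have : 0 < d * M + 2 ^ d * v + 2 ^ d * v⁻¹ := by positivity
    linarith
  · have h1 : (1 / 2 : ℝ) ^ n ≤ 2 ^ d * s ^ d := by
      have h3 : (1 / 2 : ℝ) ^ (n + d) ≤ (1 / 2) ^ (q * d) :=
        pow_le_pow_of_le_one (by norm_num) (by norm_num) (by rw [mul_comm]; omega)
      rw [pow_add, pow_mul, ← hs] at h3
      have h4 : (2 : ℝ) ^ d * (1 / 2) ^ d = 1 := by rw [← mul_pow]; norm_num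
      calc (1 / 2 : ℝ) ^ n = 2 ^ d * ((1 / 2) ^ n * (1 / 2) ^ d) := by
            rw [mul_left_comm, h4, mul_one]
        _ ≤ _ := by gcongr
    rw [hvol]
    have h2 : (1 / 2 : ℝ) ^ n * v ≤ 2 ^ d * v * s ^ d :=
      (mul_le_mul_of_nonneg_right h1 hv.le).trans_eq (by ring)
    refine h2.trans (mul_le_mul_of_nonneg_right ?_ (by positivity))
    have : 0 < d * M + 2 * M + 2 ^ d * v⁻¹ := by positivity
    linarith
  · have h1 : s ^ d ≤ 2 ^ d * (1 / 2) ^ n := by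
      have h3 : (1 / 2 : ℝ) ^ (q * d + d) ≤ (1 / 2) ^ n :=
        pow_le_pow_of_le_one (by norm_num) (by norm_num) (by rw [mul_comm]; omega)
      rw [pow_add, pow_mul, ← hs] at h3
      have h4 : (2 : ℝ) ^ d * (1 / 2) ^ d = 1 := by rw [← mul_pow]; norm_num
      calc s ^ d = 2 ^ d * (s ^ d * (1 / 2) ^ d) := by rw [mul_left_comm, h4, mul_one]
        _ ≤ _ := by gcongr
    have h2 : s ^ d ≤ 2 ^ d * v⁻¹ * ((1 / 2) ^ n * v) :=
      h1.trans_eq (by field_simp)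
    rw [hvol]
    refine h2.trans (mul_le_mul_of_nonneg_right ?_ (by positivity))
    have : 0 < d * M + 2 * M + 2 ^ d * v := by positivity
    linarith

end TSimplex

/-- Newest vertex bisection is uniformly shape regular. -/
lemma Mesh.IsMesh.exists_isShapeRegular {d : ℕ} {Ω : Set (Pt d)} {T₀ : Mesh d}
    (hT₀ : Mesh.IsMesh Ω T₀) : ∃ M : ℝ, 0 < M ∧ ∀ T ∈ Mesh.refinements Ω T₀, ∀ K ∈ T,
      ∃ s, TSimplex.IsShapeRegular M s K := by
  classical
  have h : ∀ K ∈ T₀, ∃ M : ℝ, ∀ n L, TSimplex.IsDescendant K n L →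
      ∃ s, TSimplex.IsShapeRegular M s L := fun K hK =>
    TSimplex.exists_isShapeRegular (hT₀.affineIndependent K hK) (hT₀.tag_lt K hK)
  choose! f hf using h
  obtain ⟨M, hM⟩ := Finset.exists_le (T₀.image f)
  refine ⟨max M 1, by positivity, fun T hT K hK => ?_⟩
  obtain ⟨K₀, hK₀, n, hn⟩ := Mesh.exists_ancestor hT hK
  obtain ⟨s, hs⟩ := hf K₀ hK₀ n K hn
  exact ⟨s, hs.mono ((hM _ (Finset.mem_image_of_mem f hK₀)).trans (le_max_left _ _))⟩

/-! ### Volume and surface measure of simplices -/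

/-- The integrals of a nonnegative function over almost disjoint subsets of `S`. -/
lemma sum_setIntegral_le {α ι : Type*} [MeasurableSpace α] {μ : Measure α} {F : α → ℝ}
    (hF : ∀ x, 0 ≤ F x) {S : Set α} (hS : IntegrableOn F S μ) (t : Finset ι) (s : ι → Set α)
    (hm : ∀ i ∈ t, MeasurableSet (s i)) (hs : ∀ i ∈ t, s i ⊆ S)
    (hd : ∀ i ∈ t, ∀ j ∈ t, i ≠ j → μ (s i ∩ s j) = 0) :
    ∑ i ∈ t, ∫ x in s i, F x ∂μ ≤ ∫ x in S, F x ∂μ := by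
  classical
  have key : ∑ i ∈ t, ∫ x in s i, F x ∂μ = ∫ x in ⋃ i ∈ t, s i, F x ∂μ := by
    induction t using Finset.induction_on with
    | empty => simp
    | insert a t ha ih =>
      rw [Finset.sum_insert ha, Finset.set_biUnion_insert, ih, setIntegral_union₀]
      · rw [AEDisjoint, Set.inter_iUnion₂]
        refine (measure_biUnion_null_iff t.countable_toSet).2 fun i hi => ?_
        exact hd a (by simp) i (by simp [Finset.mem_coe.1 hi]) fun h => ha (h ▸ hi)
      · exact (Finset.measurableSet_biUnion _ fun i hi => hm i (by simp [hi])).nullMeasurableSet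
      · exact hS.mono_set (hs a (by simp))
      · exact hS.mono_set (Set.iUnion₂_subset fun i hi => hs i (by simp [hi]))
      · exact fun i hi => hm i (by simp [hi])
      · exact fun i hi => hs i (by simp [hi])
      · exact fun i hi j hj => hd i (by simp [hi]) j (by simp [hj])
  rw [key]
  exact setIntegral_mono_set hS (ae_of_all _ hF)
    (Set.iUnion₂_subset fun i hi => hs i hi).eventuallyLE

/-- A simplex with `m + 1` vertices is contained in a Lipschitz image of the unit cube of
dimension `m`. -/
lemma exists_lipschitz_cube {d m : ℕ} (y : Fin (m + 1) → Pt d) {R : NNReal}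
    (hR : ∀ i, ‖y i - y 0‖ ≤ R) : ∃ Φ : (Fin m → ℝ) → Pt d, LipschitzWith (m * R) Φ ∧
      convexHull ℝ (Set.range y) ⊆ Φ '' Set.Icc 0 1 := by
  set Λ : (Fin m → ℝ) →ₗ[ℝ] Pt d := Fintype.linearCombination ℝ fun k : Fin m => y k.succ - y 0
    with hΛ
  refine ⟨fun t => Λ t + y 0, ?_, ?_⟩
  · refine LipschitzWith.of_dist_le_mul fun s t => ?_
    rw [dist_add_right, dist_eq_norm, dist_eq_norm, ← map_sub, hΛ,
      Fintype.linearCombination_apply]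
    refine (norm_sum_le _ _).trans ((Finset.sum_le_card_nsmul _ _ (R * ‖s - t‖) fun k _ => ?_).trans_eq
      (by simp [mul_assoc]))
    rw [norm_smul, mul_comm]
    exact mul_le_mul (hR _) (norm_le_pi_norm (s - t) k) (norm_nonneg _) R.2
  · have hconv : Convex ℝ ((fun t => Λ t + y 0) '' Set.Icc (0 : Fin m → ℝ) 1) := by
      have h1 := ((convex_Icc (0 : Fin m → ℝ) 1).linear_image Λ).translate (y 0)
      rw [Set.image_image] at h1
      simpa only [add_comm] using h1
    refine convexHull_min ?_ hconv
    rintro _ ⟨i, rfl⟩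
    refine Fin.cases ?_ (fun k => ?_) i
    · exact ⟨0, ⟨le_rfl, zero_le_one⟩, by simp⟩
    · refine ⟨Pi.single k 1, ⟨?_, ?_⟩, ?_⟩
      · intro j
        by_cases hj : j = k
        · subst hj; simp
        · simp [hj]
      · intro j
        by_cases hj : j = k
        · subst hj; simp
        · simp [hj]
      · simp [hΛ, Fintype.linearCombination_apply_single]

lemma surf_eq (d : ℕ) : ∃ c : NNReal, ∀ s : Set (Pt d), surf d s =
    c * Measure.hausdorffMeasure ((d - 1 : ℕ) : ℝ) s :=
  ⟨_, fun _ => rfl⟩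

/-- Flat sets of dimension less than `d - 1` have no surface measure. -/
lemma surf_convexHull_eq_zero {d : ℕ} (hd : 2 ≤ d) {V : Set (Pt d)} (hV : V.Finite)
    (hc : V.ncard < d) : surf d (convexHull ℝ V) = 0 := by
  rcases V.eq_empty_or_nonempty with rfl | hne
  · simp
  obtain ⟨m, hm⟩ := Nat.exists_eq_succ_of_ne_zero ((Set.ncard_pos hV).2 hne).ne'
  have : Finite V := hV
  let e : Fin (m + 1) ≃ V := (finCongr hm.symm).trans
    (Finite.equivFin V).symm
  set y : Fin (m + 1) → Pt d := fun i => e i with hy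
  have hr : Set.range y = V := by
    rw [show y = Subtype.val ∘ e from rfl, e.surjective.range_comp, Subtype.range_coe]
  obtain ⟨Φ, hΦ, hsub⟩ := exists_lipschitz_cube y (R := ∑ i, ‖y i - y 0‖₊) (fun i => by
    push_cast
    exact Finset.single_le_sum (f := fun i => ‖y i - y 0‖) (fun _ _ => norm_nonneg _)
      (Finset.mem_univ i))
  obtain ⟨c, hcs⟩ := surf_eq d
  have hdim : dimH (convexHull ℝ V) < ((d - 1 : ℕ) : NNReal) := by
    rw [← hr]
    refine (dimH_mono (hsub.trans (Set.image_subset_range _ _))).trans_lt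
      (hΦ.dimH_range_le.trans_lt ?_)
    rw [Real.dimH_univ_pi_fin]
    have : m < d - 1 := by omega
    exact_mod_cast this
  have := hausdorffMeasure_of_dimH_lt hdim
  rw [hcs]
  simp only [NNReal.coe_natCast] at this
  rw [this, mul_zero]

namespace TSimplex

variable {d : ℕ}

lemma vert_ncard_lt {K : TSimplex d} {i j : Fin (d + 1)} (hij : i ≠ j) :
    (K.vert '' {i, j}ᶜ).ncard < d := by
  refine (Set.ncard_image_le (Set.toFinite _)).trans_lt ?_
  rw [Set.ncard_compl, Set.ncard_pair hij]
  have := i.2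
  have := j.2
  rw [ne_eq, Fin.ext_iff] at hij
  simp
  omega

/-- Different faces of a simplex meet in a set without surface measure. -/
lemma surf_face_inter_eq_zero (hd : 2 ≤ d) {K : TSimplex d} (hK : AffineIndependent ℝ K.vert)
    {i j : Fin (d + 1)} (hij : i ≠ j) : surf d (K.face i ∩ K.face j) = 0 := by
  refine measure_mono_null ?_ (surf_convexHull_eq_zero hd ((Set.toFinite _).image _)
    (vert_ncard_lt (K := K) hij))
  rintro x ⟨hi, hj⟩
  rw [mem_face_iff hK] at hi hj
  rw [mem_convexHull_vert_iff hK]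
  refine ⟨hi.1, fun k hk => ?_⟩
  simp only [Set.mem_compl_iff, Set.mem_insert_iff, Set.mem_singleton_iff, not_not] at hk
  rcases hk with rfl | rfl
  · exact hi.2
  · exact hj.2

/-- The relative boundary of a face has no surface measure. -/
lemma surf_face_diff_eq_zero (hd : 2 ≤ d) {K : TSimplex d} (hK : AffineIndependent ℝ K.vert)
    (i : Fin (d + 1)) : surf d (K.face i \ intrinsicInterior ℝ (K.face i)) = 0 := by
  refine measure_mono_null (face_diff_intrinsicInterior_subset hK i) (measure_iUnion_null fun j => ?_)
  exact surf_convexHull_eq_zero hd ((Set.toFinite _).image _) (vert_ncard_lt (Ne.symm j.2))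

/-- The surface measure of a face is bounded by a power of its diameter. -/
lemma exists_surf_face_le (hd : 0 < d) : ∃ c : ℝ, 0 ≤ c ∧ ∀ (K : TSimplex d) (R : ℝ), 0 ≤ R →
    (∀ i j, ‖K.vert i - K.vert j‖ ≤ R) → ∀ i,
      surf d (K.face i) ≤ ENNReal.ofReal (c * R ^ (d - 1)) := by
  obtain ⟨m, rfl⟩ := Nat.exists_eq_succ_of_ne_zero hd.ne'
  obtain ⟨c, hc⟩ := surf_eq (m + 1)
  refine ⟨c * (m : ℝ) ^ m, by positivity, fun K R hR hK i => ?_⟩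
  obtain ⟨Φ, hΦ, hsub⟩ := exists_lipschitz_cube (K.vert ∘ i.succAbove) (R := R.toNNReal)
    (fun j => by rw [Real.coe_toNNReal R hR]; exact hK _ _)
  have hface : K.face i = convexHull ℝ (Set.range (K.vert ∘ i.succAbove)) := by
    rw [face, Set.range_comp, Fin.range_succAbove]
  have h1 := hΦ.hausdorffMeasure_image_le (d := (m : ℝ)) (by positivity) (Set.Icc 0 1)
  have h2 : Measure.hausdorffMeasure (m : ℝ) (Set.Icc (0 : Fin m → ℝ) 1) = 1 := by
    have h3 : (Measure.hausdorffMeasure (m : ℝ) : Measure (Fin m → ℝ)) = volume := by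
      rw [← hausdorffMeasure_pi_real, Fintype.card_fin]
    rw [h3, Real.volume_Icc_pi]; simp
  rw [h2, mul_one, ENNReal.rpow_natCast] at h1
  rw [hc, hface]
  calc (c : ENNReal) * Measure.hausdorffMeasure (m : ℝ) _ ≤ (c : ENNReal) * ((m * R.toNNReal : NNReal) : ENNReal) ^ m := by
        gcongr
        exact (measure_mono hsub).trans h1
    _ = ENNReal.ofReal (c * (m : ℝ) ^ m * R ^ m) := by
        rw [← ENNReal.coe_pow, ← ENNReal.coe_mul, ← ENNReal.ofReal_coe_nnreal]
        congr 1
        push_cast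
        rw [Real.coe_toNNReal R hR, mul_pow, mul_assoc]

lemma surf_face_lt_top (hd : 0 < d) (K : TSimplex d) (i : Fin (d + 1)) :
    surf d (K.face i) < ⊤ := by
  obtain ⟨c, -, hc⟩ := exists_surf_face_le hd
  refine (hc K (∑ i, ∑ j, ‖K.vert i - K.vert j‖) (by positivity) (fun i j => ?_) i).trans_lt
    ENNReal.ofReal_lt_top
  exact (Finset.single_le_sum (f := fun j => ‖K.vert i - K.vert j‖) (fun _ _ => norm_nonneg _)
    (Finset.mem_univ j)).trans (Finset.single_le_sum
      (f := fun i => ∑ j, ‖K.vert i - K.vert j‖) (fun _ _ => by positivity) (Finset.mem_univ i))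

lemma volume_face_eq_zero {K : TSimplex d} (hK : AffineIndependent ℝ K.vert) (i : Fin (d + 1)) :
    volume (K.face i) = 0 := by
  have h := (K.convex_face i).addHaar_frontier volume
  rwa [(K.isCompact_face i).isClosed.frontier_eq, interior_face_eq_empty hK, Set.sdiff_empty] at h

end TSimplex

namespace Mesh.IsMesh

open TSimplex

variable {d : ℕ} {Ω : Set (Pt d)} {T : Mesh d}

lemma volume_inter_eq_zero (hT : IsMesh Ω T) {K N : TSimplex d} (hK : K ∈ T) (hN : N ∈ T)
    (hne : K ≠ N) : volume (K.carrier ∩ N.carrier) = 0 := by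
  obtain ⟨i, hi⟩ := hT.exists_inter_subset_face hK hN hne
  exact measure_mono_null hi (volume_face_eq_zero (hT.affineIndependent K hK) i)

/-- Different faces of a mesh meet in a set without surface measure. -/
lemma surf_inter_eq_zero (hd : 2 ≤ d) (hT : IsMesh Ω T) {K N : TSimplex d} (hK : K ∈ T)
    (hN : N ∈ T) {i j : Fin (d + 1)} (h : K.face i ≠ N.face j) :
    surf d (K.face i ∩ N.face j) = 0 := by
  by_cases hne : K = N
  · subst hne
    exact surf_face_inter_eq_zero hd (hT.affineIndependent K hK) fun hij => h (hij ▸ rfl)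
  have hKa := hT.affineIndependent K hK
  obtain ⟨S, hS, hinter, hSN⟩ := hT.exists_inter_eq hK hN hne
  have hsub : K.face i ∩ N.face j ⊆ convexHull ℝ (K.vert '' (S ∩ {i}ᶜ)) := by
    rintro x ⟨hxi, hxj⟩
    have h1 : x ∈ convexHull ℝ (K.vert '' S) :=
      hinter ▸ ⟨K.face_subset_carrier i hxi, N.face_subset_carrier j hxj⟩
    rw [mem_convexHull_vert_iff hKa] at h1 ⊢
    refine ⟨h1.1, fun k hk => ?_⟩
    by_cases hkS : k ∈ S
    · have : k = i := by
        by_contra hki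
        exact hk ⟨hkS, hki⟩
      rw [this]
      exact ((mem_face_iff hKa).1 hxi).2
    · exact h1.2 k hkS
  by_cases hSi : {i}ᶜ ⊆ S
  · -- The two elements share the face of `K`, which is another face of `N`.
    obtain ⟨l, hl⟩ := exists_face_eq hKa (hT.affineIndependent N hN)
      ((Set.image_mono hSi).trans hSN)
    have hfl : K.face i = N.face l := by rw [face, face, hl]
    rw [hfl]
    exact surf_face_inter_eq_zero hd (hT.affineIndependent N hN) fun hlj => h (hlj ▸ hfl)
  · obtain ⟨k, hk, hkS⟩ := Set.not_subset.1 hSi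
    have hki : i ≠ k := fun e => hk e.symm
    refine measure_mono_null (hsub.trans (convexHull_mono (Set.image_mono ?_)))
      (surf_convexHull_eq_zero hd ((Set.toFinite _).image _) (vert_ncard_lt (K := K) hki))
    rintro l ⟨hlS, hli⟩ hl
    rcases hl with rfl | rfl
    · exact hli rfl
    · exact hkS hlS

end Mesh.IsMesh

/-! ### The stress of a discrete function -/

/-- A Lipschitz domain lies on one side of its boundary. -/
lemma HasLipschitzBoundary.interior_closure_subset {d : ℕ} {Ω : Set (Pt d)} (hΩ : IsOpen Ω)
    (h : HasLipschitzBoundary Ω) : interior (closure Ω) ⊆ Ω := by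
  intro x hx
  by_contra hxΩ
  have hfr : x ∈ frontier Ω := ⟨interior_subset hx, by rwa [hΩ.interior_eq]⟩
  obtain ⟨e, he, L, γ, hγ, hev⟩ := h x hfr
  have hγc := hγ.continuous
  have hx0 : inner ℝ e x ≤ γ (x - inner ℝ e x • e) := by
    by_contra hlt
    exact hxΩ (hev.self_of_nhds.2 (not_le.1 hlt))
  -- Points slightly below `x` in the direction `-e` are not in the closure.
  have hcont : Tendsto (fun s : ℝ => x + s • e) (𝓝[<] 0) (𝓝 x) := by
    have : Continuous fun s : ℝ => x + s • e := by fun_prop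
    simpa using (this.tendsto 0).mono_left nhdsWithin_le_nhds
  obtain ⟨s, ⟨h1, h2⟩, hs⟩ := ((hcont.eventually
    ((eventually_eventually_nhds.2 hev).and (mem_interior_iff_mem_nhds.1 hx))).and
      self_mem_nhdsWithin).exists
  have hs : s < 0 := hs
  have hin : inner ℝ e (x + s • e) = inner ℝ e x + s := by
    rw [inner_add_right, inner_smul_right, real_inner_self_eq_norm_sq, he]; ring
  have hlt : inner ℝ e (x + s • e) < γ (x + s • e - inner ℝ e (x + s • e) • e) := by
    have : x + s • e - (inner ℝ e x + s) • e = x - inner ℝ e x • e := by module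
    rw [hin, this]; linarith
  have hopen : ∀ᶠ y in 𝓝 (x + s • e), inner ℝ e y < γ (y - inner ℝ e y • e) := by
    refine (isOpen_lt ?_ ?_).mem_nhds hlt
    · fun_prop
    · exact hγc.comp (by fun_prop)
  obtain ⟨y, hyΩ, hy1, hy2⟩ :=
    ((mem_closure_iff_frequently.1 h2).and_eventually (h1.and hopen)).exists
  exact (hy1.1 hyΩ).not_gt hy2

namespace Problem

open TSimplex Mesh.IsMesh

variable {d : ℕ} {P : Problem d} {T : Mesh d}

lemma interior_carrier_subset (hT : Mesh.IsMesh P.Ω T) {K : TSimplex d} (hK : K ∈ T) :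
    interior K.carrier ⊆ P.Ω :=
  (interior_mono (hT.carrier_subset_closure hK)).trans
    (P.lipschitz.interior_closure_subset P.isOpen)

lemma volume_carrier_diff_interior (K : TSimplex d) : volume (K.carrier \ interior K.carrier) = 0 :=
  measure_mono_null (Set.sdiff_subset_sdiff_left subset_closure)
    (K.convex_carrier.addHaar_frontier volume)

lemma volume_carrier_diff (hT : Mesh.IsMesh P.Ω T) {K : TSimplex d} (hK : K ∈ T) :
    volume (K.carrier \ P.Ω) = 0 :=
  measure_mono_null (Set.sdiff_subset_sdiff_right (interior_carrier_subset hT hK))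
    (volume_carrier_diff_interior K)

lemma restrict_carrier_le (hT : Mesh.IsMesh P.Ω T) {K : TSimplex d} (hK : K ∈ T) :
    volume.restrict K.carrier ≤ volume.restrict P.Ω :=
  Measure.restrict_mono_ae (ae_le_set.2 (volume_carrier_diff hT hK))

lemma closure_ae_eq (hT : Mesh.IsMesh P.Ω T) : (closure P.Ω : Set (Pt d)) =ᵐ[volume] P.Ω := by
  refine (ae_le_set.2 ?_).antisymm subset_closure.eventuallyLE
  rw [hT.cover, Set.iUnion_sdiff]
  simp only [Set.iUnion_sdiff]
  exact (measure_biUnion_null_iff T.countable_toSet).2 fun K hK => volume_carrier_diff hT hK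

lemma isFiniteMeasure_restrict (P : Problem d) : IsFiniteMeasure (volume.restrict P.Ω) :=
  ⟨by rw [Measure.restrict_apply_univ]; exact P.isBounded.measure_lt_top⟩

/-- The weak gradient of a field that is affine on an element is constant there. -/
lemma grad_ae_eq (hT : Mesh.IsMesh P.Ω T) {K : TSimplex d} (hK : K ∈ T) {z : Fields d}
    (hz : P.MemX z) {A : Pt d →ᵃ[ℝ] Pt d} (hA : ∀ᵐ x ∂volume.restrict K.carrier, z.v x = A x)
    (i j : Fin d) : ∀ᵐ x ∂volume.restrict K.carrier,
      z.grad x i j = A.linear (EuclideanSpace.single j 1) i := by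
  have := isFiniteMeasure_restrict P
  set c : ℝ := A.linear (EuclideanSpace.single j 1) i with hc
  have hKm : MeasurableSet K.carrier := K.isCompact_carrier.measurableSet
  have hAi : ∀ x, HasFDerivAt (fun x => A x i)
      ((EuclideanSpace.proj i : Pt d →L[ℝ] ℝ).comp (LinearMap.toContinuousLinearMap A.linear)) x := by
    intro x
    have h1 : HasFDerivAt (fun x => LinearMap.toContinuousLinearMap A.linear x + A 0)
        (LinearMap.toContinuousLinearMap A.linear) x :=
      (LinearMap.toContinuousLinearMap A.linear).hasFDerivAt.add_const _
    have h2 : (fun x => LinearMap.toContinuousLinearMap A.linear x + A 0) = A :=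
      (AffineMap.decomp A).symm
    rw [h2] at h1
    exact (EuclideanSpace.proj i : Pt d →L[ℝ] ℝ).hasFDerivAt.comp x h1
  have hAc : Continuous fun x => A x i :=
    continuous_iff_continuousAt.2 fun x => (hAi x).continuousAt
  have hG : Integrable (fun x => z.grad x i j) (volume.restrict P.Ω) :=
    (hz.grad_memLp i j).integrable (by norm_num)
  have key : ∀ᵐ x ∂volume.restrict P.Ω, x ∈ interior K.carrier → z.grad x i j - c = 0 := by
    refine isOpen_interior.ae_eq_zero_of_integral_contDiff_smul_eq_zero
      ((hG.sub (integrable_const c)).locallyIntegrable.locallyIntegrableOn _) ?_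
    intro φ hφ hφc hφs
    have hφΩ : tsupport φ ⊆ P.Ω := hφs.trans (interior_carrier_subset hT hK)
    have hφcont := hφ.continuous
    have hdcont : Continuous (partialDeriv φ j) :=
      (hφ.continuous_fderiv (by simp)).clm_apply continuous_const
    have hds : tsupport (partialDeriv φ j) ⊆ tsupport φ := tsupport_fderiv_apply_subset ℝ _
    have hdc : HasCompactSupport (partialDeriv φ j) :=
      hφc.isCompact.of_isClosed_subset (isClosed_tsupport _) hds
    have hφ0 : ∀ x ∉ P.Ω, φ x = 0 := fun x hx => image_eq_zero_of_notMem_tsupport fun h => hx (hφΩ h)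
    have hd0 : ∀ x ∉ interior K.carrier, partialDeriv φ j x = 0 := fun x hx =>
      image_eq_zero_of_notMem_tsupport fun h => hx (hφs (hds h))
    have hw := hz.weakGradient φ hφ hφc hφΩ i j
    have h1 : ∫ x in P.Ω, z.v x i * partialDeriv φ j x = ∫ x, A x i * partialDeriv φ j x := by
      have hA' : ∀ᵐ x, x ∈ K.carrier → z.v x = A x := (ae_restrict_iff' hKm).1 hA
      rw [← setIntegral_eq_integral_of_forall_compl_eq_zero (s := P.Ω) (f := fun x =>
        A x i * partialDeriv φ j x)]
      · refine integral_congr_ae (ae_restrict_of_ae ?_)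
        filter_upwards [hA'] with x hx
        by_cases hxK : x ∈ interior K.carrier
        · rw [hx (interior_subset hxK)]
        · rw [hd0 x hxK, mul_zero, mul_zero]
      · intro x hx
        rw [hd0 x fun h => hx (interior_carrier_subset hT hK h), mul_zero]
    have h2 : ∫ x, A x i * partialDeriv φ j x = - ∫ x, c * φ x := by
      have hfd : ∀ x, fderiv ℝ (fun x => A x i) x (EuclideanSpace.single j 1) = c := fun x => by
        rw [(hAi x).fderiv]; rfl
      have := integral_mul_fderiv_eq_neg_fderiv_mul_of_integrable (μ := (volume : Measure (Pt d)))
        (f := fun x => A x i) (g := φ) (v := EuclideanSpace.single j 1) ?_ ?_ ?_ ?_ ?_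
      · simp only [hfd] at this
        exact this
      · simp only [hfd]
        exact (hφcont.integrable_of_hasCompactSupport hφc).const_mul c
      · exact (hAc.mul hdcont).integrable_of_hasCompactSupport hdc.mul_left
      · exact (hAc.mul hφcont).integrable_of_hasCompactSupport hφc.mul_left
      · exact fun x _ => (hAi x).differentiableAt
      · exact fun x _ => (hφ.differentiable (by simp)) x
    have h3 : ∫ x, c * φ x = ∫ x in P.Ω, c * φ x :=
      (setIntegral_eq_integral_of_forall_compl_eq_zero fun x hx => by rw [hφ0 x hx, mul_zero]).symm
    rw [h1, h2, h3, neg_inj] at hw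
    have hbound : ∃ C, ∀ x, ‖φ x‖ ≤ C := hφcont.bounded_above_of_compact_support hφc
    obtain ⟨C, hC⟩ := hbound
    have hi1 : Integrable (fun x => z.grad x i j * φ x) (volume.restrict P.Ω) :=
      hG.mul_bdd hφcont.aestronglyMeasurable (ae_of_all _ hC)
    have hi2 : Integrable (fun x => c * φ x) (volume.restrict P.Ω) :=
      ((hφcont.integrable_of_hasCompactSupport hφc).const_mul c).restrict
    calc ∫ x in P.Ω, φ x • (z.grad x i j - c)
        = ∫ x in P.Ω, (z.grad x i j * φ x - c * φ x) := by
          refine integral_congr_ae (ae_of_all _ fun x => ?_)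
          simp only [smul_eq_mul]; ring
      _ = 0 := by rw [integral_sub hi1 hi2, hw, sub_self]
  have h4 : ∀ᵐ x ∂volume.restrict K.carrier, x ∈ interior K.carrier := by
    rw [ae_restrict_iff' hKm, ae_iff]
    refine measure_mono_null ?_ (volume_carrier_diff_interior K)
    intro x hx
    simpa using hx
  filter_upwards [ae_mono (restrict_carrier_le hT hK) key, h4] with x hx hx4
  exact sub_eq_zero.1 (hx hx4)

/-- The stress of a discrete function is constant on each element. -/
lemma stress_ae_eq (hT : Mesh.IsMesh P.Ω T) {K : TSimplex d} (hK : K ∈ T) {z : Fields d}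
    (hz : P.MemXh T z) : ∀ᵐ x ∂volume.restrict K.carrier, P.stress z x = P.stressOn z K := by
  obtain ⟨A, hA⟩ := hz.v_affine K hK
  obtain ⟨c, -, -, hc⟩ := hz.q_const K hK
  set G : Mat d := fun i j => A.linear (EuclideanSpace.single j 1) i
  have hG : ∀ᵐ x ∂volume.restrict K.carrier, z.grad x = G := by
    have h : ∀ᵐ x ∂volume.restrict K.carrier, ∀ i j, z.grad x i j = G i j :=
      ae_all_iff.2 fun i => ae_all_iff.2 fun j => grad_ae_eq hT hK hz.memX hA i j
    filter_upwards [h] with x hx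
    ext i j
    exact hx i j
  set S : Mat d := P.elast ((1 / 2 : ℝ) • (G + G.transpose) - c) with hS
  have hstress : ∀ᵐ x ∂volume.restrict K.carrier, P.stress z x = S := by
    filter_upwards [hG, hc] with x hx hcx
    rw [stress, Fields.strain, hx, hcx]
  have hmean : P.stressOn z K = S := by
    ext i j
    have h1 : ⨍ x in K.carrier, P.stress z x i j = ⨍ _x in K.carrier, S i j := by
      refine average_congr ?_
      filter_upwards [hstress] with x hx
      rw [hx]
    rw [stressOn, h1]
    have hpos := volume_carrier_pos (hT.affineIndependent K hK)
    refine setAverage_const (fun h0 => ?_) K.isCompact_carrier.measure_lt_top.ne _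
    rw [Measure.real, h0] at hpos
    simp at hpos
  rw [hmean]
  exact hstress

/-- The squared error is the sum of the elementwise squared differences of the stresses, whatever
coarse element that contains it is used for each element of the fine mesh. -/
lemma sum_volume_mul_le_dist_sq (hT : Mesh.IsMesh P.Ω T) {T' : Mesh d} (hT' : Mesh.IsMesh P.Ω T')
    {z z' : Fields d} (hz : P.MemXh T z) (hz' : P.MemXh T' z') {anc : TSimplex d → TSimplex d}
    (hanc : ∀ K ∈ T', anc K ∈ T) (hsub : ∀ K ∈ T', K.carrier ⊆ (anc K).carrier) :
    ∑ K ∈ T', volume.real K.carrier * matNorm (P.stressOn z' K - P.stressOn z (anc K)) ^ 2 ≤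
      P.dist z' z ^ 2 := by
  set F : Pt d → ℝ := fun x => matNorm (P.stress z' x - P.stress z x) ^ 2 with hF
  have hF0 : ∀ x, 0 ≤ F x := fun x => sq_nonneg _
  have hconst : ∀ K ∈ T', ∀ᵐ x ∂volume.restrict K.carrier,
      F x = matNorm (P.stressOn z' K - P.stressOn z (anc K)) ^ 2 := by
    intro K hK
    filter_upwards [stress_ae_eq hT' hK hz', ae_restrict_of_ae_restrict_of_subset (hsub K hK)
      (stress_ae_eq hT (hanc K hK) hz)] with x h1 h2
    rw [hF]
    beta_reduce
    rw [h1, h2]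
  have hint : ∀ K ∈ T', IntegrableOn F K.carrier := by
    intro K hK
    refine (integrableOn_const (C := matNorm (P.stressOn z' K - P.stressOn z (anc K)) ^ 2)
      K.isCompact_carrier.measure_lt_top.ne).congr ?_
    filter_upwards [hconst K hK] with x hx using hx.symm
  have hintΩ : IntegrableOn F (closure P.Ω) := by
    rw [hT'.cover]
    exact (integrableOn_finset_iUnion).2 hint
  calc _ = ∑ K ∈ T', ∫ x in K.carrier, F x := by
        refine Finset.sum_congr rfl fun K hK => ?_
        rw [integral_congr_ae (hconst K hK), setIntegral_const, smul_eq_mul]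
    _ ≤ ∫ x in closure P.Ω, F x := by
        refine sum_setIntegral_le hF0 hintΩ T' _ (fun K _ => K.isCompact_carrier.measurableSet)
          (fun K hK => hT'.carrier_subset_closure hK) fun K hK N hN hne => ?_
        exact hT'.volume_inter_eq_zero hK hN hne
    _ = ∫ x in P.Ω, F x := setIntegral_congr_set (closure_ae_eq hT')
    _ = P.dist z' z ^ 2 := by
        rw [Problem.dist, Real.sq_sqrt (integral_nonneg hF0)]

end Problem

/-! ### Local comparison of the residuals -/

lemma matNorm_sq {d : ℕ} (A : Mat d) : matNorm A ^ 2 = ∑ i, ∑ j, A i j ^ 2 := by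
  rw [matNorm, Real.sq_sqrt]
  · simp [ddot, sq]
  · exact Finset.sum_nonneg fun i _ => Finset.sum_nonneg fun j _ => mul_self_nonneg _

lemma matNorm_sub_sq_le {d : ℕ} (A B : Mat d) :
    matNorm (A - B) ^ 2 ≤ 2 * matNorm A ^ 2 + 2 * matNorm B ^ 2 := by
  simp only [matNorm_sq, Finset.mul_sum, ← Finset.sum_add_distrib, Matrix.sub_apply]
  refine Finset.sum_le_sum fun i _ => Finset.sum_le_sum fun j _ => ?_
  nlinarith [sq_nonneg (A i j + B i j)]

lemma matVec_sub {d : ℕ} (A B : Mat d) (n : Pt d) : matVec (A - B) n = matVec A n - matVec B n := by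
  rw [matVec, Matrix.sub_mulVec]; rfl

lemma norm_matVec_sq_le {d : ℕ} (A : Mat d) {n : Pt d} (hn : ‖n‖ = 1) :
    ‖matVec A n‖ ^ 2 ≤ matNorm A ^ 2 := by
  have h1 : ∑ j, n j ^ 2 = 1 := by
    have := EuclideanSpace.real_norm_sq_eq n
    rw [hn] at this
    linarith
  rw [EuclideanSpace.real_norm_sq_eq, matNorm_sq]
  refine Finset.sum_le_sum fun i _ => ?_
  calc (∑ j, A i j * n j) ^ 2 ≤ (∑ j, A i j ^ 2) * ∑ j, n j ^ 2 :=
        Finset.sum_mul_sq_le_sq_mul_sq _ _ _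
    _ = _ := by rw [h1, mul_one]

/-- The inequality of Young, with the constants that are used for the reduction. -/
lemma norm_add_sq_le_young {E : Type*} [NormedAddCommGroup E] (x y : E) :
    ‖x + y‖ ^ 2 ≤ 5 / 4 * ‖x‖ ^ 2 + 5 * ‖y‖ ^ 2 := by
  have h := norm_add_le x y
  have h0 := norm_nonneg (x + y)
  nlinarith [sq_nonneg (‖x‖ - 4 * ‖y‖), norm_nonneg x, norm_nonneg y]

namespace Problem

open TSimplex Mesh.IsMesh

variable {d : ℕ} {P : Problem d} {T T' : Mesh d}

open Classical in
/-- The function on the `i`-th face of `K` whose integral is the squared residual. -/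
noncomputable def residualDensity (P : Problem d) (T : Mesh d) (z : Fields d) (K : TSimplex d)
    (i : Fin (d + 1)) (x : Pt d) : ℝ :=
  if T.IsInterior K i then
    ∑ K' ∈ T.neighbors K i, ‖matVec (P.stressOn z K - P.stressOn z K') (K.normal i)‖ ^ 2
  else if intrinsicInterior ℝ (K.face i) ⊆ P.ΓN then
    ‖P.g x - matVec (P.stressOn z K) (K.normal i)‖ ^ 2
  else 0

lemma residualDensity_nonneg (z : Fields d) (K : TSimplex d) (i : Fin (d + 1)) (x : Pt d) :
    0 ≤ P.residualDensity T z K i x := by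
  unfold residualDensity
  split_ifs <;> positivity

lemma isFiniteMeasure_restrict_face (hd : 0 < d) (K : TSimplex d) (i : Fin (d + 1)) :
    IsFiniteMeasure ((surf d).restrict (K.face i)) :=
  ⟨by rw [Measure.restrict_apply_univ]; exact K.surf_face_lt_top hd i⟩

lemma residualSq_eq_integral (hd : 0 < d) (z : Fields d) (K : TSimplex d) (i : Fin (d + 1)) :
    P.residualSq T z K i = ∫ x in K.face i, P.residualDensity T z K i x ∂surf d := by
  have := isFiniteMeasure_restrict_face hd K i
  unfold residualSq residualDensity
  split_ifs
  · rw [integral_finsetSum _ fun _ _ => integrable_const _]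
  · rfl
  · simp

/-- The square of the boundary residual is integrable, since the relative boundary of a face is
a null set. -/
lemma integrableOn_neumann (hd : 2 ≤ d) {K : TSimplex d} (hK : AffineIndependent ℝ K.vert)
    {i : Fin (d + 1)} (h : intrinsicInterior ℝ (K.face i) ⊆ P.ΓN) (v : Pt d) :
    IntegrableOn (fun x => ‖P.g x - v‖ ^ 2) (K.face i) (surf d) := by
  have := isFiniteMeasure_restrict_face (by omega) K i
  have hle : (surf d).restrict (K.face i) ≤ (surf d).restrict P.ΓN :=
    Measure.restrict_mono_ae (ae_le_set.2 (measure_mono_null (Set.sdiff_subset_sdiff_right h)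
      (surf_face_diff_eq_zero hd hK i)))
  have hg : MemLp P.g 2 ((surf d).restrict (K.face i)) := P.g_memLp.mono_measure hle
  exact (hg.sub (memLp_const v)).integrable_norm_pow two_ne_zero

lemma integrableOn_residualDensity (hd : 2 ≤ d) (z : Fields d) {K : TSimplex d}
    (hK : AffineIndependent ℝ K.vert) (i : Fin (d + 1)) :
    IntegrableOn (P.residualDensity T z K i) (K.face i) (surf d) := by
  have := isFiniteMeasure_restrict_face (by omega) K i
  unfold residualDensity
  split_ifs with h1 h2
  · exact integrable_const _
  · exact integrableOn_neumann hd hK h2 _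
  · exact integrable_const _

/-- The squared difference of the stresses on an element and on the coarse element `anc K`. -/
noncomputable def stressErrorSq (P : Problem d) (z z' : Fields d)
    (anc : TSimplex d → TSimplex d) (K : TSimplex d) : ℝ :=
  matNorm (P.stressOn z' K - P.stressOn z (anc K)) ^ 2

lemma stressErrorSq_nonneg (z z' : Fields d) (anc : TSimplex d → TSimplex d) (K : TSimplex d) :
    0 ≤ P.stressErrorSq z z' anc K := sq_nonneg _

open Classical in
/-- The part of the coarse residuals that belongs to a face of a finer element: the integral of
the residual over this face, if it lies in a face of the coarse element `N`, and zero else. -/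
noncomputable def coarseResidual (P : Problem d) (T : Mesh d) (z : Fields d) (N K : TSimplex d)
    (i : Fin (d + 1)) : ℝ :=
  ∑ j, if K.face i ⊆ N.face j then ∫ x in K.face i, P.residualDensity T z N j x ∂surf d else 0

lemma coarseResidual_nonneg (z : Fields d) (N K : TSimplex d) (i : Fin (d + 1)) :
    0 ≤ P.coarseResidual T z N K i := by
  classical
  refine Finset.sum_nonneg fun j _ => ?_
  split_ifs
  · exact integral_nonneg fun x => residualDensity_nonneg z N j x
  · exact le_rfl

lemma integral_le_coarseResidual (z : Fields d) {N K : TSimplex d} {i j : Fin (d + 1)}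
    (h : K.face i ⊆ N.face j) :
    ∫ x in K.face i, P.residualDensity T z N j x ∂surf d ≤ P.coarseResidual T z N K i := by
  classical
  have h1 := Finset.single_le_sum (s := Finset.univ) (f := fun j => if K.face i ⊆ N.face j then
    ∫ x in K.face i, P.residualDensity T z N j x ∂surf d else 0) (fun j _ => by
      beta_reduce
      split_ifs
      · exact integral_nonneg fun x => residualDensity_nonneg z N j x
      · exact le_rfl) (Finset.mem_univ j)
  beta_reduce at h1
  rw [if_pos h] at h1
  exact h1

/-- On an interior face, the residual is bounded by that of the coarse mesh and the differences
of the stresses. A face inside a coarse element has no coarse residual, because the coarse stress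
does not jump there. -/
lemma residualSq_le_of_isInterior (hd : 2 ≤ d) (hT : Mesh.IsMesh P.Ω T) (hT' : Mesh.IsMesh P.Ω T') (z z' : Fields d) {anc : TSimplex d → TSimplex d}
    (hanc : ∀ K ∈ T', anc K ∈ T) (hsub : ∀ K ∈ T', K.carrier ⊆ (anc K).carrier)
    {K : TSimplex d} (hK : K ∈ T')
    {i : Fin (d + 1)} (hint : T'.IsInterior K i) :
    P.residualSq T' z' K i ≤ 5 / 4 * P.coarseResidual T z (anc K) K i +
      10 * (surf d).real (K.face i) * (P.stressErrorSq z z' anc K +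
        ∑ N ∈ T'.neighbors K i, P.stressErrorSq z z' anc N) := by
  have hd0 : 0 < d := by omega
  have hKa := hT'.affineIndependent K hK
  have hAa := hT.affineIndependent _ (hanc K hK)
  have hA := coarseResidual_nonneg (P := P) (T := T) z (anc K) K i
  have hm := stressErrorSq_nonneg (P := P) z z' anc K
  have hs : 0 ≤ (surf d).real (K.face i) := measureReal_nonneg
  have hν := norm_normal hd0 hKa i
  obtain ⟨N, hN, hne, ⟨j, hj⟩, hnb⟩ := hT'.exists_neighbors_eq hd0 hK hint
  have hres' : P.residualSq T' z' K i = (surf d).real (K.face i) *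
      ‖matVec (P.stressOn z' K - P.stressOn z' N) (K.normal i)‖ ^ 2 := by
    rw [residualSq, if_pos hint, hnb, Finset.sum_singleton, setIntegral_const, smul_eq_mul]
  have hmN := stressErrorSq_nonneg (P := P) z z' anc N
  rw [hres', hnb, Finset.sum_singleton]
  set τK := P.stressOn z' K - P.stressOn z (anc K) with hτK
  set τN := P.stressOn z' N - P.stressOn z (anc N) with hτN
  have hτ : ‖matVec (τK - τN) (K.normal i)‖ ^ 2 ≤
      2 * (P.stressErrorSq z z' anc K + P.stressErrorSq z z' anc N) :=
    ((norm_matVec_sq_le _ hν).trans (matNorm_sub_sq_le _ _)).trans_eq (by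
      simp only [stressErrorSq]; ring)
  by_cases hAN : anc K = anc N
  · have : P.stressOn z' K - P.stressOn z' N = τK - τN := by rw [hτK, hτN, hAN]; abel
    rw [this]
    have h1 := mul_le_mul_of_nonneg_left hτ hs
    have h2 := mul_nonneg hs (add_nonneg hm hmN)
    linarith
  · have hl : K.face i ⊆ (anc K).carrier ∩ (anc N).carrier :=
      Set.subset_inter ((K.face_subset_carrier i).trans (hsub K hK))
        (hj ▸ (N.face_subset_carrier j).trans (hsub N hN))
    obtain ⟨k, l, hkl, hface⟩ := hT.exists_common_face (hanc K hK) (hanc N hN) hAN hKa hl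
    have hkl' : (anc N).face l = (anc K).face k := by rw [face, face, hkl]
    have hintA : T.IsInterior (anc K) k := ⟨anc N, hanc N hN, Ne.symm hAN, l, hkl'⟩
    have hνA : K.normal i = (anc K).normal k := normal_eq_of_subset hd0 hKa hAa (hsub K hK) hface
    set J := ‖matVec (P.stressOn z (anc K) - P.stressOn z (anc N)) (K.normal i)‖ ^ 2 with hJ
    have h1 : (surf d).real (K.face i) * J ≤ P.coarseResidual T z (anc K) K i := by
      refine le_trans ?_ (integral_le_coarseResidual z hface)
      unfold residualDensity
      simp only [if_pos hintA]
      rw [setIntegral_const, smul_eq_mul]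
      refine mul_le_mul_of_nonneg_left ?_ hs
      rw [hJ, hνA]
      exact Finset.single_le_sum (f := fun N => ‖matVec (P.stressOn z (anc K) - P.stressOn z N)
        ((anc K).normal k)‖ ^ 2) (fun _ _ => sq_nonneg _)
          (Mesh.IsMesh.mem_neighbors_iff.2 ⟨hanc N hN, Ne.symm hAN, l, hkl'⟩)
    have h2 : ‖matVec (P.stressOn z' K - P.stressOn z' N) (K.normal i)‖ ^ 2 ≤
        5 / 4 * J + 5 * ‖matVec (τK - τN) (K.normal i)‖ ^ 2 := by
      refine le_trans (le_of_eq ?_) (norm_add_sq_le_young _ _)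
      congr 2
      simp only [hτK, hτN, matVec_sub]
      abel
    calc _ ≤ (surf d).real (K.face i) * (5 / 4 * J +
          5 * (2 * (P.stressErrorSq z z' anc K + P.stressErrorSq z z' anc N))) :=
          mul_le_mul_of_nonneg_left (h2.trans (by linarith)) hs
      _ = 5 / 4 * ((surf d).real (K.face i) * J) + 10 * (surf d).real (K.face i) *
          (P.stressErrorSq z z' anc K + P.stressErrorSq z z' anc N) := by ring
      _ ≤ _ := by linarith

/-- On a boundary face, the coarse and the fine mesh have the same boundary condition. -/
lemma residualSq_le_of_not_isInterior (hd : 2 ≤ d) (hT : Mesh.IsMesh P.Ω T) (hT' : Mesh.IsMesh P.Ω T')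
    (hres : P.Resolves T) (z z' : Fields d) {anc : TSimplex d → TSimplex d}
    (hanc : ∀ K ∈ T', anc K ∈ T) (hsub : ∀ K ∈ T', K.carrier ⊆ (anc K).carrier)
    {K : TSimplex d} (hK : K ∈ T')
    {i : Fin (d + 1)} (hint : ¬ T'.IsInterior K i) :
    P.residualSq T' z' K i ≤ 5 / 4 * P.coarseResidual T z (anc K) K i +
      10 * (surf d).real (K.face i) * (P.stressErrorSq z z' anc K +
        ∑ N ∈ T'.neighbors K i, P.stressErrorSq z z' anc N) := by
  have hd0 : 0 < d := by omega
  have hKa := hT'.affineIndependent K hK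
  have hAa := hT.affineIndependent _ (hanc K hK)
  have hfin := isFiniteMeasure_restrict_face hd0 K i
  have hA := coarseResidual_nonneg (P := P) (T := T) z (anc K) K i
  have hm := stressErrorSq_nonneg (P := P) z z' anc K
  have hs : 0 ≤ (surf d).real (K.face i) := measureReal_nonneg
  have hν := norm_normal hd0 hKa i
  have hm' : 0 ≤ ∑ N ∈ T'.neighbors K i, P.stressErrorSq z z' anc N :=
    Finset.sum_nonneg fun N _ => stressErrorSq_nonneg z z' anc N
  have hrhs : 0 ≤ 10 * (surf d).real (K.face i) * ∑ N ∈ T'.neighbors K i,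
      P.stressErrorSq z z' anc N := mul_nonneg (mul_nonneg (by norm_num) hs) hm'
  by_cases hN : intrinsicInterior ℝ (K.face i) ⊆ P.ΓN
  · obtain ⟨k, hface, hk⟩ := hT.exists_boundary_face hd0 hT' (hanc K hK) hK (hsub K hK) hint
    have hNA : intrinsicInterior ℝ ((anc K).face k) ⊆ P.ΓN := by
      rcases hres _ (hanc K hK) k hk with h | h
      · exact absurd (h (hface (faceCenter_mem_face hd0 hKa i)))
          (hN (faceCenter_mem_intrinsicInterior hd0 hKa i)).2
      · exact h
    have hνA : K.normal i = (anc K).normal k := normal_eq_of_subset hd0 hKa hAa (hsub K hK) hface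
    have h1 : ∫ x in K.face i, ‖P.g x - matVec (P.stressOn z (anc K)) (K.normal i)‖ ^ 2 ∂surf d ≤
        P.coarseResidual T z (anc K) K i := by
      refine le_trans (le_of_eq ?_) (integral_le_coarseResidual z hface)
      unfold residualDensity
      simp only [if_neg hk, if_pos hNA]
      rw [hνA]
    have hpt : ∀ x, ‖P.g x - matVec (P.stressOn z' K) (K.normal i)‖ ^ 2 ≤
        5 / 4 * ‖P.g x - matVec (P.stressOn z (anc K)) (K.normal i)‖ ^ 2 +
          5 * P.stressErrorSq z z' anc K := by
      intro x
      have h2 := norm_matVec_sq_le (P.stressOn z (anc K) - P.stressOn z' K) hν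
      have h3 := norm_add_sq_le_young (P.g x - matVec (P.stressOn z (anc K)) (K.normal i))
        (matVec (P.stressOn z (anc K) - P.stressOn z' K) (K.normal i))
      have h4 : matNorm (P.stressOn z (anc K) - P.stressOn z' K) ^ 2 =
          P.stressErrorSq z z' anc K := by
        simp only [stressErrorSq, matNorm_sq, Matrix.sub_apply]
        exact Finset.sum_congr rfl fun _ _ => Finset.sum_congr rfl fun _ _ => by ring
      rw [matVec_sub, sub_add_sub_cancel, ← matVec_sub] at h3
      linarith
    have hI := integrableOn_neumann (P := P) hd hKa hN
    have h5 : P.residualSq T' z' K i ≤ ∫ x in K.face i,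
        (5 / 4 * ‖P.g x - matVec (P.stressOn z (anc K)) (K.normal i)‖ ^ 2 +
          5 * P.stressErrorSq z z' anc K) ∂surf d := by
      rw [residualSq, if_neg hint, if_pos hN]
      exact integral_mono (hI _) (((hI _).const_mul _).add (integrable_const _)) hpt
    rw [integral_add ((hI _).const_mul _) (integrable_const _), integral_const_mul,
      setIntegral_const, smul_eq_mul] at h5
    have h6 := mul_nonneg hs hm
    linarith
  · rw [residualSq, if_neg hint, if_neg hN, mul_add]
    have h1 := mul_nonneg (mul_nonneg (by norm_num : (0 : ℝ) ≤ 10) hs) hm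
    linarith

lemma residualSq_le (hd : 2 ≤ d) (hT : Mesh.IsMesh P.Ω T) (hT' : Mesh.IsMesh P.Ω T')
    (hres : P.Resolves T) (z z' : Fields d) {anc : TSimplex d → TSimplex d}
    (hanc : ∀ K ∈ T', anc K ∈ T) (hsub : ∀ K ∈ T', K.carrier ⊆ (anc K).carrier)
    {K : TSimplex d} (hK : K ∈ T')
    (i : Fin (d + 1)) :
    P.residualSq T' z' K i ≤ 5 / 4 * P.coarseResidual T z (anc K) K i +
      10 * (surf d).real (K.face i) * (P.stressErrorSq z z' anc K +
        ∑ N ∈ T'.neighbors K i, P.stressErrorSq z z' anc N) := by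
  by_cases hint : T'.IsInterior K i
  · exact residualSq_le_of_isInterior hd hT hT' z z' hanc hsub hK hint
  · exact residualSq_le_of_not_isInterior hd hT hT' hres z z' hanc hsub hK hint

end Problem

/-! ### Summation over the refined elements -/

/-- The scaling of the residuals: a face and its adjacent elements have comparable size. -/
lemma exists_sqrt_volume_mul_surf_le {d : ℕ} (hd : 2 ≤ d) {Ω : Set (Pt d)} {T₀ : Mesh d}
    (hT₀ : Mesh.IsMesh Ω T₀) : ∃ C : ℝ, 0 ≤ C ∧ ∀ T ∈ Mesh.refinements Ω T₀, ∀ K ∈ T, ∀ N ∈ T,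
      ∀ i, K.vert '' {i}ᶜ ⊆ Set.range N.vert →
        √(volume.real K.carrier) * (surf d).real (K.face i) ≤ C * volume.real N.carrier := by
  obtain ⟨M, hM, hreg⟩ := hT₀.exists_isShapeRegular
  obtain ⟨c, hc, hsurf⟩ := TSimplex.exists_surf_face_le (d := d) (by omega)
  refine ⟨√M * (c * M ^ (d - 1)) * ((M * M) ^ d * M), by positivity, fun T hT K hK N hN i hi => ?_⟩
  obtain ⟨s, hs⟩ := hreg T hT K hK
  obtain ⟨t, ht⟩ := hreg T hT N hN
  have hs0 := hs.pos
  have ht0 := ht.pos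
  -- A face has an edge, whose length is comparable to the sizes of both elements.
  have hst : s ≤ M * M * t := by
    have hcard : 1 < ({i}ᶜ : Set (Fin (d + 1))).ncard := by
      rw [Set.ncard_compl]; simp; omega
    obtain ⟨a, ha, b, hb, hab⟩ := (Set.one_lt_ncard (Set.toFinite _)).1 hcard
    obtain ⟨a', ha'⟩ := hi ⟨a, ha, rfl⟩
    obtain ⟨b', hb'⟩ := hi ⟨b, hb, rfl⟩
    have h1 := hs.le_edge a b hab
    have h2 := ht.edge_le a' b'
    rw [ha', hb'] at h2
    calc s ≤ M * ‖K.vert a - K.vert b‖ := h1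
      _ ≤ M * (M * t) := mul_le_mul_of_nonneg_left h2 hM.le
      _ = M * M * t := by ring
  have h1 : (surf d).real (K.face i) ≤ c * M ^ (d - 1) * s ^ (d - 1) := by
    have h := hsurf K (M * s) (by positivity) hs.edge_le i
    rw [mul_pow, ← mul_assoc] at h
    exact ENNReal.toReal_le_of_le_ofReal (by positivity) h
  have h2 : √(volume.real K.carrier) ≤ √M * s := by
    refine Real.sqrt_le_iff.2 ⟨by positivity, ?_⟩
    rw [mul_pow, Real.sq_sqrt hM.le]
    exact hs.volume_le.trans (mul_le_mul_of_nonneg_left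
      (pow_le_pow_of_le_one hs0.le hs.le_one hd) hM.le)
  calc √(volume.real K.carrier) * (surf d).real (K.face i)
      ≤ (√M * s) * (c * M ^ (d - 1) * s ^ (d - 1)) :=
        mul_le_mul h2 h1 measureReal_nonneg (by positivity)
    _ = √M * (c * M ^ (d - 1)) * s ^ d := by
        obtain ⟨m, rfl⟩ := Nat.exists_eq_succ_of_ne_zero (by omega : d ≠ 0)
        rw [Nat.succ_eq_add_one, Nat.add_sub_cancel, pow_succ s]
        ring
    _ ≤ √M * (c * M ^ (d - 1)) * ((M * M * t) ^ d) := by gcongr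
    _ = √M * (c * M ^ (d - 1)) * ((M * M) ^ d * t ^ d) := by rw [mul_pow]
    _ ≤ √M * (c * M ^ (d - 1)) * ((M * M) ^ d * (M * volume.real N.carrier)) := by
        have := ht.le_volume
        gcongr
    _ = _ := by ring

namespace Problem

open TSimplex Mesh.IsMesh

variable {d : ℕ} {P : Problem d} {T T' : Mesh d}

lemma face_injective (hd : 0 < d) {K : TSimplex d} (hK : AffineIndependent ℝ K.vert) :
    Function.Injective K.face := by
  intro i j hij
  have h := ((mem_face_iff hK).1 (hij ▸ faceCenter_mem_face hd hK i)).2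
  rw [coord_faceCenter hd] at h
  by_contra hne
  rw [if_neg (Ne.symm hne)] at h
  exact (by positivity : (d : ℝ)⁻¹ ≠ 0) h

/-- The element contributions of the fine mesh inside a coarse element add up to at most the
coarse contribution. -/
lemma sum_integral_f_le (hT : Mesh.IsMesh P.Ω T) (hT' : Mesh.IsMesh P.Ω T') {N : TSimplex d}
    (hN : N ∈ T) (t : Finset (TSimplex d)) (ht : t ⊆ T')
    (hsub : ∀ K ∈ t, K.carrier ⊆ N.carrier) :
    ∑ K ∈ t, ∫ x in K.carrier, ‖P.f x‖ ^ 2 ≤ ∫ x in N.carrier, ‖P.f x‖ ^ 2 := by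
  have hf : MemLp P.f 2 (volume.restrict N.carrier) :=
    P.f_memLp.mono_measure (restrict_carrier_le hT hN)
  refine sum_setIntegral_le (fun x => sq_nonneg _) (hf.integrable_norm_pow two_ne_zero) t _
    (fun K _ => K.isCompact_carrier.measurableSet) hsub fun K hK L hL hne => ?_
  exact hT'.volume_inter_eq_zero (ht hK) (ht hL) hne

/-- The coarse residuals that belong to the faces of the fine mesh inside a coarse element add up
to at most the residuals of the coarse element. -/
lemma sum_coarseResidual_le (hd : 2 ≤ d) (hT : Mesh.IsMesh P.Ω T) (hT' : Mesh.IsMesh P.Ω T')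
    (z : Fields d) {N : TSimplex d} (hN : N ∈ T) (t : Finset (TSimplex d)) (ht : t ⊆ T')
    (hsub : ∀ K ∈ t, K.carrier ⊆ N.carrier) :
    ∑ K ∈ t, ∑ i, P.coarseResidual T z N K i ≤ ∑ j, P.residualSq T z N j := by
  classical
  have hd0 : 0 < d := by omega
  have hNa := hT.affineIndependent N hN
  have hswap : ∑ K ∈ t, ∑ i, P.coarseResidual T z N K i =
      ∑ j, ∑ p ∈ (t ×ˢ Finset.univ).filter (fun p : TSimplex d × Fin (d + 1) =>
        p.1.face p.2 ⊆ N.face j), ∫ x in p.1.face p.2, P.residualDensity T z N j x ∂surf d := by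
    simp only [Finset.sum_filter, coarseResidual]
    rw [← Finset.sum_product' t Finset.univ (fun K i => ∑ j, if K.face i ⊆ N.face j then
      ∫ x in K.face i, P.residualDensity T z N j x ∂surf d else 0)]
    exact Finset.sum_comm
  rw [hswap]
  refine Finset.sum_le_sum fun j _ => ?_
  rw [residualSq_eq_integral hd0]
  refine sum_setIntegral_le (fun x => residualDensity_nonneg z N j x)
    (integrableOn_residualDensity hd z hNa j) _
    (fun p : TSimplex d × Fin (d + 1) => p.1.face p.2)
    (fun p _ => (p.1.isCompact_face p.2).measurableSet)
    (fun p hp => (Finset.mem_filter.1 hp).2) ?_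
  rintro ⟨K, k⟩ hK ⟨L, l⟩ hL hne
  simp only [Finset.mem_filter, Finset.mem_product, Finset.mem_univ, and_true] at hK hL
  have hKT := ht hK.1
  have hLT := ht hL.1
  refine hT'.surf_inter_eq_zero hd hKT hLT fun hface => hne ?_
  by_cases hKL : K = L
  · subst hKL
    exact congrArg (K, ·) (face_injective hd0 (hT'.affineIndependent K hKT) hface)
  · -- Different elements that share a face do not lie on the same side of it.
    exfalso
    have h1 := hT'.normal_eq_neg hd0 hKT hLT hKL hface
    rw [normal_eq_of_subset hd0 (hT'.affineIndependent K hKT) hNa (hsub K hK.1) hK.2,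
      normal_eq_of_subset hd0 (hT'.affineIndependent L hLT) hNa (hsub L hL.1) hL.2] at h1
    have h2 : (2 : ℝ) • N.normal j = 0 := by
      rw [two_smul]; nth_rewrite 1 [h1]; simp
    have h3 := norm_normal hd0 hNa j
    rw [(smul_eq_zero.1 h2).resolve_left two_ne_zero, norm_zero] at h3
    exact zero_ne_one h3

/-- Every element is a neighbour of at most one element across each of its faces. -/
lemma sum_sum_neighbors_le (hd : 0 < d) (hT : Mesh.IsMesh P.Ω T) {G : TSimplex d → ℝ}
    (hG : ∀ K, 0 ≤ G K) : ∑ K ∈ T, ∑ i, ∑ N ∈ T.neighbors K i, G N ≤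
      ((d + 1 : ℕ) : ℝ) ^ 2 * ∑ N ∈ T, G N := by
  classical
  have hcard : ∀ N ∈ T, ∀ j, ((T.neighbors N j).card : ℝ) ≤ 1 := by
    intro N hN j
    by_cases h : T.IsInterior N j
    · obtain ⟨L, -, -, -, hL⟩ := hT.exists_neighbors_eq hd hN h
      rw [hL]; simp
    · have : T.neighbors N j = ∅ := by
        refine Finset.eq_empty_of_forall_notMem fun L hL => h ?_
        obtain ⟨h1, h2, h3⟩ := mem_neighbors_iff.1 hL
        exact ⟨L, h1, h2, h3⟩
      rw [this]; simp
  have hstep : ∀ K ∈ T, ∀ i, ∑ N ∈ T.neighbors K i, G N ≤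
      ∑ N ∈ T, ∑ j, if K ∈ T.neighbors N j then G N else 0 := by
    intro K hK i
    have hsub : T.neighbors K i ⊆ T := fun N hN => (mem_neighbors_iff.1 hN).1
    calc ∑ N ∈ T.neighbors K i, G N
        ≤ ∑ N ∈ T.neighbors K i, ∑ j, (if K ∈ T.neighbors N j then G N else 0) := by
          refine Finset.sum_le_sum fun N hN => ?_
          obtain ⟨h1, h2, j, hj⟩ := mem_neighbors_iff.1 hN
          have hKN : K ∈ T.neighbors N j := mem_neighbors_iff.2 ⟨hK, h2.symm, i, hj.symm⟩
          calc G N = if K ∈ T.neighbors N j then G N else 0 := (if_pos hKN).symm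
            _ ≤ _ := Finset.single_le_sum (f := fun j => if K ∈ T.neighbors N j then G N else 0)
              (fun j _ => by split_ifs; exacts [hG N, le_rfl]) (Finset.mem_univ j)
      _ ≤ _ := Finset.sum_le_sum_of_subset_of_nonneg hsub fun N _ _ =>
          Finset.sum_nonneg fun j _ => by split_ifs; exacts [hG N, le_rfl]
  calc ∑ K ∈ T, ∑ i, ∑ N ∈ T.neighbors K i, G N
      ≤ ∑ K ∈ T, ∑ _i : Fin (d + 1), ∑ N ∈ T, ∑ j, (if K ∈ T.neighbors N j then G N else 0) :=
        Finset.sum_le_sum fun K hK => Finset.sum_le_sum fun i _ => hstep K hK i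
    _ = ((d + 1 : ℕ) : ℝ) * ∑ N ∈ T, ∑ j : Fin (d + 1),
          ∑ K ∈ T, (if K ∈ T.neighbors N j then G N else 0) := by
        simp only [Finset.sum_const, Finset.card_univ, Fintype.card_fin, nsmul_eq_mul]
        rw [← Finset.mul_sum, Finset.sum_comm]
        congr 1
        exact Finset.sum_congr rfl fun N _ => Finset.sum_comm
    _ ≤ ((d + 1 : ℕ) : ℝ) * ∑ N ∈ T, ∑ _j : Fin (d + 1), G N := by
        refine mul_le_mul_of_nonneg_left (Finset.sum_le_sum fun N hN =>
          Finset.sum_le_sum fun j _ => ?_) (Nat.cast_nonneg _)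
        rw [← Finset.sum_filter, Finset.sum_const, nsmul_eq_mul]
        have h1 : ((T.filter fun K => K ∈ T.neighbors N j).card : ℝ) ≤ 1 := by
          refine le_trans ?_ (hcard N hN j)
          exact_mod_cast Finset.card_le_card fun K hK => (Finset.mem_filter.1 hK).2
        calc _ ≤ 1 * G N := mul_le_mul_of_nonneg_right h1 (hG N)
          _ = G N := one_mul _
    _ = _ := by
        simp only [Finset.sum_const, Finset.card_univ, Fintype.card_fin, nsmul_eq_mul]
        rw [← Finset.mul_sum]; ring

/-- The indicator of a fine element is bounded by its share of the coarse indicator, with a smaller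
factor due to the decrease of the volume, and by differences of the stresses. -/
lemma etaSq_le (hd : 2 ≤ d) (hT : Mesh.IsMesh P.Ω T) (hT' : Mesh.IsMesh P.Ω T')
    (hres : P.Resolves T) (z z' : Fields d) {anc : TSimplex d → TSimplex d}
    (hanc : ∀ K ∈ T', anc K ∈ T) (hsub : ∀ K ∈ T', K.carrier ⊆ (anc K).carrier) {C : ℝ}
    (hC : ∀ K ∈ T', ∀ N ∈ T', ∀ i, K.vert '' {i}ᶜ ⊆ Set.range N.vert →
      √(volume.real K.carrier) * (surf d).real (K.face i) ≤ C * volume.real N.carrier)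
    {K : TSimplex d} (hK : K ∈ T')
    (hvol : volume.real K.carrier ≤ 1 / 2 * volume.real (anc K).carrier) :
    P.etaSq T' z' K ≤ 9 / 10 * (volume.real (anc K).carrier * ∫ x in K.carrier, ‖P.f x‖ ^ 2) +
      9 / 10 * (√(volume.real (anc K).carrier) * ∑ i, P.coarseResidual T z (anc K) K i) +
      10 * C * ∑ i, (volume.real K.carrier * P.stressErrorSq z z' anc K +
        ∑ N ∈ T'.neighbors K i, volume.real N.carrier * P.stressErrorSq z z' anc N) := by
  have hf : 0 ≤ ∫ x in K.carrier, ‖P.f x‖ ^ 2 := integral_nonneg fun x => sq_nonneg _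
  have hv : 0 ≤ volume.real (anc K).carrier := measureReal_nonneg
  have h1 : volume.real K.carrier * (∫ x in K.carrier, ‖P.f x‖ ^ 2) ≤
      9 / 10 * (volume.real (anc K).carrier * ∫ x in K.carrier, ‖P.f x‖ ^ 2) := by
    rw [← mul_assoc]
    exact mul_le_mul_of_nonneg_right (by linarith) hf
  -- The factor `√(1/2)` is less than `18/25`, and `5/4 * 18/25 = 9/10`.
  have h2 : √(volume.real K.carrier) ≤ 18 / 25 * √(volume.real (anc K).carrier) := by
    refine Real.sqrt_le_iff.2 ⟨by positivity, ?_⟩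
    rw [mul_pow, Real.sq_sqrt hv]
    linarith
  have h3 : √(volume.real K.carrier) * ∑ i, P.residualSq T' z' K i ≤
      ∑ i, (9 / 10 * (√(volume.real (anc K).carrier) * P.coarseResidual T z (anc K) K i) +
        10 * C * (volume.real K.carrier * P.stressErrorSq z z' anc K +
          ∑ N ∈ T'.neighbors K i, volume.real N.carrier * P.stressErrorSq z z' anc N)) := by
    rw [Finset.mul_sum]
    refine Finset.sum_le_sum fun i _ => ?_
    have hr := mul_le_mul_of_nonneg_left (residualSq_le hd hT hT' hres z z' hanc hsub hK i)
      (Real.sqrt_nonneg (volume.real K.carrier))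
    have hA := mul_le_mul_of_nonneg_right h2
      (coarseResidual_nonneg (P := P) (T := T) z (anc K) K i)
    have hB := mul_le_mul_of_nonneg_right (hC K hK K hK i (Set.image_subset_range _ _))
      (stressErrorSq_nonneg (P := P) z z' anc K)
    have hD : √(volume.real K.carrier) * (surf d).real (K.face i) *
        ∑ N ∈ T'.neighbors K i, P.stressErrorSq z z' anc N ≤
        C * ∑ N ∈ T'.neighbors K i, volume.real N.carrier * P.stressErrorSq z z' anc N := by
      rw [Finset.mul_sum, Finset.mul_sum]
      refine Finset.sum_le_sum fun N hN => ?_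
      obtain ⟨hNT, -, j, hj⟩ := mem_neighbors_iff.1 hN
      have hvert := hT'.vert_image_eq_of_face_eq hK hNT hj.symm
      rw [← mul_assoc]
      exact mul_le_mul_of_nonneg_right
        (hC K hK N hNT i (hvert ▸ Set.image_subset_range _ _)) (stressErrorSq_nonneg z z' anc N)
    nlinarith [hr, hA, hB, hD]
  rw [Finset.sum_add_distrib, ← Finset.mul_sum, ← Finset.mul_sum, ← Finset.mul_sum] at h3
  rw [etaSq]
  linarith

/-- The reduction of the estimator on the refined elements for a pair of meshes. -/
lemma sum_etaSq_le (hd : 2 ≤ d) (hT : Mesh.IsMesh P.Ω T)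
    (hT' : T' ∈ Mesh.refinements P.Ω T) (hres : P.Resolves T) {z z' : Fields d}
    (hz : P.MemXh T z) (hz' : P.MemXh T' z') {C : ℝ} (hC0 : 0 ≤ C)
    (hC : ∀ K ∈ T', ∀ N ∈ T', ∀ i, K.vert '' {i}ᶜ ⊆ Set.range N.vert →
      √(volume.real K.carrier) * (surf d).real (K.face i) ≤ C * volume.real N.carrier) :
    ∑ K ∈ T' \ T, P.etaSq T' z' K ≤ 9 / 10 * ∑ K ∈ T \ T', P.etaSq T z K +
      10 * C * (((d + 1 : ℕ) : ℝ) + ((d + 1 : ℕ) : ℝ) ^ 2) * P.dist z' z ^ 2 := by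
  classical
  have hd0 : 0 < d := by omega
  have hTm' := hT.of_mem_refinements hT'
  have hex : ∀ K ∈ T', ∃ N ∈ T, K.carrier ⊆ N.carrier ∧
      (K ∉ T → N ∈ T \ T' ∧ volume.real K.carrier ≤ 1 / 2 * volume.real N.carrier) := by
    intro K hK
    by_cases hKT : K ∈ T
    · exact ⟨K, hKT, subset_rfl, fun h => absurd hKT h⟩
    · obtain ⟨N, hN, h1, h2⟩ := Mesh.exists_refined_ancestor hT hT' (Finset.mem_sdiff.2 ⟨hK, hKT⟩)
      exact ⟨N, (Finset.mem_sdiff.1 hN).1, h1, fun _ => ⟨hN, h2⟩⟩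
  have : Nonempty (TSimplex d) := ⟨⟨0, 0⟩⟩
  choose! anc hanc hsub hanc' using hex
  have hmaps : ∀ K ∈ T' \ T, anc K ∈ T \ T' := fun K hK =>
    (hanc' K (Finset.mem_sdiff.1 hK).1 (Finset.mem_sdiff.1 hK).2).1
  set m := P.stressErrorSq z z' anc with hm
  have hG : ∀ K : TSimplex d, 0 ≤ volume.real K.carrier * m K := fun K =>
    mul_nonneg measureReal_nonneg (stressErrorSq_nonneg z z' anc K)
  have hdist : ∑ K ∈ T', volume.real K.carrier * m K ≤ P.dist z' z ^ 2 :=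
    sum_volume_mul_le_dist_sq hT hTm' hz hz' hanc hsub
  -- The contributions of the coarse mesh, sorted by coarse elements.
  have hcoarse : ∑ K ∈ T' \ T,
      ((volume.real (anc K).carrier * ∫ x in K.carrier, ‖P.f x‖ ^ 2) +
        √(volume.real (anc K).carrier) * ∑ i, P.coarseResidual T z (anc K) K i) ≤
      ∑ N ∈ T \ T', P.etaSq T z N := by
    rw [← Finset.sum_fiberwise_of_maps_to hmaps]
    refine Finset.sum_le_sum fun N hN => ?_
    have hNT := (Finset.mem_sdiff.1 hN).1
    set t := (T' \ T).filter fun K => anc K = N with ht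
    have htT' : t ⊆ T' := fun K hK => (Finset.mem_sdiff.1 (Finset.mem_filter.1 hK).1).1
    have htsub : ∀ K ∈ t, K.carrier ⊆ N.carrier := fun K hK =>
      (Finset.mem_filter.1 hK).2 ▸ hsub K (htT' hK)
    have h1 : ∑ K ∈ t, ((volume.real (anc K).carrier * ∫ x in K.carrier, ‖P.f x‖ ^ 2) +
        √(volume.real (anc K).carrier) * ∑ i, P.coarseResidual T z (anc K) K i) =
        (volume.real N.carrier * ∑ K ∈ t, ∫ x in K.carrier, ‖P.f x‖ ^ 2) +
          √(volume.real N.carrier) * ∑ K ∈ t, ∑ i, P.coarseResidual T z N K i := by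
      rw [Finset.mul_sum, Finset.mul_sum, ← Finset.sum_add_distrib]
      exact Finset.sum_congr rfl fun K hK => by rw [(Finset.mem_filter.1 hK).2]
    rw [h1, etaSq]
    exact add_le_add
      (mul_le_mul_of_nonneg_left (sum_integral_f_le hT hTm' hNT t htT' htsub) measureReal_nonneg)
      (mul_le_mul_of_nonneg_left (sum_coarseResidual_le hd hT hTm' z hNT t htT' htsub)
        (Real.sqrt_nonneg _))
  have herror : ∑ K ∈ T' \ T, ∑ i, (volume.real K.carrier * m K +
      ∑ N ∈ T'.neighbors K i, volume.real N.carrier * m N) ≤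
      (((d + 1 : ℕ) : ℝ) + ((d + 1 : ℕ) : ℝ) ^ 2) * P.dist z' z ^ 2 := by
    calc _ ≤ ∑ K ∈ T', ∑ i, (volume.real K.carrier * m K +
          ∑ N ∈ T'.neighbors K i, volume.real N.carrier * m N) :=
          Finset.sum_le_sum_of_subset_of_nonneg Finset.sdiff_subset fun K _ _ =>
            Finset.sum_nonneg fun i _ => add_nonneg (hG K) (Finset.sum_nonneg fun N _ => hG N)
      _ = ((d + 1 : ℕ) : ℝ) * ∑ K ∈ T', volume.real K.carrier * m K +
          ∑ K ∈ T', ∑ i, ∑ N ∈ T'.neighbors K i, volume.real N.carrier * m N := by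
          simp only [Finset.sum_add_distrib, Finset.sum_const, Finset.card_univ, Fintype.card_fin,
            nsmul_eq_mul, Finset.mul_sum]
      _ ≤ ((d + 1 : ℕ) : ℝ) * ∑ K ∈ T', volume.real K.carrier * m K +
          ((d + 1 : ℕ) : ℝ) ^ 2 * ∑ K ∈ T', volume.real K.carrier * m K :=
          add_le_add_right (sum_sum_neighbors_le hd0 hTm' hG) _
      _ = (((d + 1 : ℕ) : ℝ) + ((d + 1 : ℕ) : ℝ) ^ 2) * ∑ K ∈ T', volume.real K.carrier * m K := by
          ring
      _ ≤ _ := mul_le_mul_of_nonneg_left hdist (by positivity)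
  have hmain := Finset.sum_le_sum fun K (hK : K ∈ T' \ T) =>
    etaSq_le hd hT hTm' hres z z' hanc hsub hC (Finset.mem_sdiff.1 hK).1
      (hanc' K (Finset.mem_sdiff.1 hK).1 (Finset.mem_sdiff.1 hK).2).2
  refine hmain.trans ?_
  rw [Finset.sum_add_distrib, Finset.sum_add_distrib, ← Finset.mul_sum, ← Finset.mul_sum,
    ← Finset.mul_sum, ← mul_add, ← Finset.sum_add_distrib, mul_assoc (10 * C)]
  exact add_le_add (mul_le_mul_of_nonneg_left hcoarse (by norm_num))
    (mul_le_mul_of_nonneg_left herror (by positivity))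

end Problem

end ElastoAFEM

open ElastoAFEM
theorem lemma4p2 {d : ℕ} (hd : d = 2 ∨ d = 3) (P : Problem d)
    (T₀ : Mesh d) (hT₀ : Mesh.IsMesh P.Ω T₀) (hres : P.Resolves T₀) :
    ∃ ρ₂ C₂ : ℝ, 0 < ρ₂ ∧ ρ₂ < 1 ∧ 0 < C₂ ∧
      ∀ T ∈ Mesh.refinements P.Ω T₀, ∀ T' ∈ Mesh.refinements P.Ω T,
      ∀ U U' : Fields d, P.IsDiscreteSolution T U → P.IsDiscreteSolution T' U' →
        ∑ K ∈ T' \ T, P.etaSq T' U' K ≤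
          ρ₂ * ∑ K ∈ T \ T', P.etaSq T U K + C₂ * P.dist U' U ^ 2 := by
  have hd2 : 2 ≤ d := by omega
  obtain ⟨C, hC0, hC⟩ := exists_sqrt_volume_mul_surf_le hd2 hT₀
  refine ⟨9 / 10, 10 * C * (((d + 1 : ℕ) : ℝ) + ((d + 1 : ℕ) : ℝ) ^ 2) + 1, by norm_num,
    by norm_num, by positivity, fun T hT T' hT' U U' hU hU' => ?_⟩
  have hTm := hT₀.of_mem_refinements hT
  have hresT : P.Resolves T := hres.of_finer (by omega) hT₀ hTm fun K hK => by
    obtain ⟨N, hN, n, h⟩ := Mesh.exists_ancestor hT hK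
    exact ⟨N, hN, (h.props (hT₀.affineIndependent N hN) (hT₀.tag_lt N hN)).2.2.1⟩
  have h := Problem.sum_etaSq_le hd2 hTm hT' hresT hU.1 hU'.1 hC0
    (hC T' (Relation.ReflTransGen.trans hT hT'))
  have h1 := sq_nonneg (P.dist U' U)
  linarith
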